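/- Let $K$ be a field of characteristic zero (for instance $\mathbb{R}$ or $\mathbb{C}$). Let $x,y,u_{ij}$ $(i,j\ge 0)$ be the canonical coordinates on the jet spaces of functions on the plane $K^2$, where $u_{ij}([f]_p)=\frac{\partial^{i+j}f}{\partial x^i\partial y^j}(p)$, let $\mathcal F=K(x,y,u_{ij}: i,j\ge0)$ be the field of rational functions on the jet spaces of all finite orders, and let $\frac{d}{dx},\frac{d}{dy}$ be the total derivatives on $\mathcal F$. For an affine transformation $A$ of $K^2$ and $c\in K^\times$ consider the action $[f]_p\mapsto[c\,(f\circ A^{-1})]_{Ap}$ on jets. A function $I\in\mathcal F$ is a rational affine differential invariant if it is invariant under these transformations with $c=1$ and all $A$; it is a rational affine differential invariant of algebraic curves $P=0$ (where $P$ is defined up to a nonzero factor) if it is invariant under them for all $A$ and all $c\neq0$. An $I\in\mathcal F$ has weight $w$ if $\gamma(I)=wI$, where $\gamma=\sum_{i,j}u_{ij}\frac{\partial}{\partial u_{ij}}$. Let $I_0=u_{00}$ and $$I_2=\frac{u_{01}^2u_{20}-2u_{10}u_{01}u_{11}+u_{10}^2u_{02}}{u_{20}u_{02}-u_{11}^2},$$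 let $\omega_1=u_{10}\,dx+u_{01}\,dy$ and $\omega_2=\frac{dI_2}{dx}dx+\frac{dI_2}{dy}dy$ (these are linearly independent over $\mathcal F$), and define $I_{ij}\in\mathcal F$ by the expansions of symmetric tensors $$\Theta_k=\sum_{i=0}^k u_{i,k-i}\frac{dx^i}{i!}\frac{dy^{k-i}}{(k-i)!}=\sum_{i=0}^k I_{i,k-i}\frac{\omega_1^i}{i!}\frac{\omega_2^{k-i}}{(k-i)!},\qquad k\ge 0 .$$ Then the rational affine differential invariants of algebraic curves are exactly the rational affine differential invariants of weight zero, and they form the subfield of $\mathcal F$ generated over $K$ by the functions $I_{ij}I_0^{\,i+j-1}$, $i,j\ge0$. In particular each of these functions is such an invariant, and every such invariant is a rational function, with coefficients in $K$, of finitely many of them. -/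

import Mathlib

namespace AffineJets

noncomputable section

/-- Coordinates on the infinite jet space of functions on the plane: the base coordinates
`x`, `y` (`Sum.inl 0`, `Sum.inl 1`) and the jet coordinates `u_{ij}` (`Sum.inr (i, j)`). -/
abbrev JetVar : Type := Fin 2 ⊕ ℕ × ℕ

/-- Polynomial functions on the jet spaces (of all finite orders). -/
abbrev JetRing (K : Type*) [Field K] := MvPolynomial JetVar K

/-- The field of rational functions on the jet spaces (of all finite orders). -/
abbrev JetField (K : Type*) [Field K] := FractionRing (JetRing K)

variable {K : Type*} [Field K]

/-- The jet coordinate `u_{ij}`, i.e. `∂^{i+j} f / ∂x^i ∂y^j`. -/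
def u (i j : ℕ) : JetRing K := MvPolynomial.X (Sum.inr (i, j))

/-- The total derivatives `d/dx = ∂_x + ∑ u_{i+1,j} ∂_{u_{ij}}` (`k = 0`) and
`d/dy = ∂_y + ∑ u_{i,j+1} ∂_{u_{ij}}` (`k = 1`). -/
def totalDeriv (k : Fin 2) : Derivation K (JetRing K) (JetRing K) :=
  MvPolynomial.mkDerivation K
    (Sum.elim (fun i => if i = k then 1 else 0)
      (fun ij => if k = 0 then u (ij.1 + 1) ij.2 else u ij.1 (ij.2 + 1)))

/-- The total derivative along a constant vector field `v` on the plane. -/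
def totalDerivAlong (v : Fin 2 → K) : Derivation K (JetRing K) (JetRing K) :=
  v 0 • totalDeriv 0 + v 1 • totalDeriv 1

/-- The pullback of polynomial functions along the prolongation to the jets of the
transformation `f ↦ c · (f ∘ A⁻¹)`, i.e. along `[f]_p ↦ [c · (f ∘ A⁻¹)]_{A p}`.
The base point is moved by `A`; by the chain rule `∂_k (f ∘ A⁻¹)` at `A p` is the derivative of `f`
at `p` along the vector `A.linear⁻¹ e_k`, whence the formula for the `u_{ij}`. -/
def prolongRing (A : (Fin 2 → K) ≃ᵃ[K] (Fin 2 → K)) (c : Kˣ) : JetRing K →ₐ[K] JetRing K :=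
  MvPolynomial.aeval
    (Sum.elim
      (fun i => MvPolynomial.C (A 0 i)
        + ∑ j : Fin 2, MvPolynomial.C (A.linear (Pi.single j 1) i) * MvPolynomial.X (Sum.inl j))
      (fun ij : ℕ × ℕ => MvPolynomial.C (c : K) *
        (totalDerivAlong (A.linear.symm (Pi.single 0 1)))^[ij.1]
          ((totalDerivAlong (A.linear.symm (Pi.single 1 1)))^[ij.2] (u 0 0))))

theorem totalDeriv_comm (k l : Fin 2) (P : JetRing K) :
    totalDeriv k (totalDeriv l P) = totalDeriv l (totalDeriv k P) := by
  have h : ⁅totalDeriv (K := K) k, totalDeriv (K := K) l⁆ = 0 := by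
    apply MvPolynomial.derivation_ext
    rintro (i | ⟨i, j⟩)
    · simp only [Derivation.commutator_apply, totalDeriv, MvPolynomial.mkDerivation_X, Sum.elim_inl]
      split_ifs <;> simp
    · fin_cases k <;> fin_cases l <;>
        simp [Derivation.commutator_apply, totalDeriv, u, MvPolynomial.mkDerivation_X]
  have h2 := congrArg (fun D => D P) h
  simpa [Derivation.commutator_apply, sub_eq_zero] using h2

theorem totalDerivAlong_comm (v w : Fin 2 → K) (P : JetRing K) :
    totalDerivAlong v (totalDerivAlong w P) = totalDerivAlong w (totalDerivAlong v P) := by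
  simp only [totalDerivAlong, Derivation.add_apply, Derivation.smul_apply, map_add,
    Derivation.map_smul, totalDeriv_comm 1 0, smul_add, smul_smul]
  rw [mul_comm (w 0) (v 0), mul_comm (w 1) (v 1), mul_comm (w 0) (v 1), mul_comm (w 1) (v 0)]
  abel

theorem prolongRing_totalDeriv (A : (Fin 2 → K) ≃ᵃ[K] (Fin 2 → K)) (c : Kˣ) (k : Fin 2)
    (P : JetRing K) :
    prolongRing A c (totalDeriv k P) =
      totalDerivAlong (A.linear.symm (Pi.single k 1)) (prolongRing A c P) := by
  induction P using MvPolynomial.induction_on with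
  | C a =>
    rw [← MvPolynomial.algebraMap_eq, Derivation.map_algebraMap, AlgHom.commutes,
      Derivation.map_algebraMap, map_zero]
  | add p q hp hq => simp only [map_add, hp, hq]
  | mul_X p s hp =>
    simp only [Derivation.leibniz, map_add, map_mul, smul_eq_mul, hp]
    congr 2
    rcases s with i | ⟨i, j⟩
    · have hw : ∀ w : Fin 2 → K, A.linear w i =
          w 0 * A.linear (Pi.single 0 1) i + w 1 * A.linear (Pi.single 1 1) i := by
        intro w
        have : w = w 0 • (Pi.single 0 1 : Fin 2 → K) + w 1 • (Pi.single 1 1 : Fin 2 → K) := by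
          ext t; fin_cases t <;> simp
        conv_lhs => rw [this]
        simp
      have h := hw (A.linear.symm (Pi.single k 1))
      rw [LinearEquiv.apply_symm_apply] at h
      have h2 := congrArg (MvPolynomial.C (σ := JetVar)) h
      simp only [prolongRing, MvPolynomial.aeval_X, totalDeriv, totalDerivAlong,
        MvPolynomial.mkDerivation_X, Sum.elim_inl, Derivation.add_apply, Derivation.smul_apply,
        map_add, Fin.sum_univ_two, Derivation.leibniz, MvPolynomial.derivation_C, smul_eq_mul,
        MvPolynomial.smul_eq_C_mul]
      simp only [map_add, map_mul] at h2
      have e : (MvPolynomial.aeval (R := K) (S₁ := JetRing K)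
          (Sum.elim
            (fun i => MvPolynomial.C (A 0 i) + (MvPolynomial.C (A.linear (Pi.single 0 1) i)
                * MvPolynomial.X (Sum.inl 0) + MvPolynomial.C (A.linear (Pi.single 1 1) i)
                * MvPolynomial.X (Sum.inl 1)))
            (fun ij : ℕ × ℕ => MvPolynomial.C (c : K) *
              (totalDerivAlong (A.linear.symm (Pi.single 0 1)))^[ij.1]
                ((totalDerivAlong (A.linear.symm (Pi.single 1 1)))^[ij.2] (u 0 0)))))
          (if i = k then (1 : JetRing K) else 0) =
          MvPolynomial.C ((Pi.single k 1 : Fin 2 → K) i) := by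
        rw [Pi.single_apply]
        split_ifs <;> simp
      refine Eq.trans e (h2.trans ?_)
      simp
      ring
    · have hX : ∀ a b : ℕ, prolongRing A c (u a b) = MvPolynomial.C (c : K) *
          (totalDerivAlong (A.linear.symm (Pi.single 0 1)))^[a]
            ((totalDerivAlong (A.linear.symm (Pi.single 1 1)))^[b] (u 0 0)) := by
        intro a b
        simp [prolongRing, u]
      change prolongRing A c (totalDeriv k (u i j)) =
        totalDerivAlong (A.linear.symm (Pi.single k 1)) (prolongRing A c (u i j))
      rw [hX, ← MvPolynomial.smul_eq_C_mul, Derivation.map_smul]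
      fin_cases k
      · have : totalDeriv (K := K) 0 (u i j) = u (i + 1) j := by
          simp [totalDeriv, u, MvPolynomial.mkDerivation_X]
        change prolongRing A c (totalDeriv 0 (u i j)) = _
        rw [this, hX, Function.iterate_succ_apply', MvPolynomial.smul_eq_C_mul]
        rfl
      · have : totalDeriv (K := K) 1 (u i j) = u i (j + 1) := by
          simp [totalDeriv, u, MvPolynomial.mkDerivation_X]
        change prolongRing A c (totalDeriv 1 (u i j)) = _
        rw [this, hX, Function.iterate_succ_apply', MvPolynomial.smul_eq_C_mul]
        congr 1
        exact (Function.Commute.iterate_right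
          (fun P => totalDerivAlong_comm (A.linear.symm (Pi.single 1 1))
            (A.linear.symm (Pi.single 0 1)) P) i).symm _

theorem prolongRing_totalDerivAlong (A : (Fin 2 → K) ≃ᵃ[K] (Fin 2 → K)) (c : Kˣ) (v : Fin 2 → K)
    (P : JetRing K) :
    prolongRing A c (totalDerivAlong v P) =
      totalDerivAlong (A.linear.symm v) (prolongRing A c P) := by
  have hv : v = v 0 • (Pi.single 0 1 : Fin 2 → K) + v 1 • (Pi.single 1 1 : Fin 2 → K) := by
    ext t; fin_cases t <;> simp
  have h : A.linear.symm v = v 0 • A.linear.symm (Pi.single 0 1) +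
      v 1 • A.linear.symm (Pi.single 1 1) := by
    conv_lhs => rw [hv]
    simp
  rw [h]
  rw [show totalDerivAlong v P = v 0 • totalDeriv 0 P + v 1 • totalDeriv 1 P from rfl, map_add,
    map_smul, map_smul, prolongRing_totalDeriv, prolongRing_totalDeriv]
  simp only [totalDerivAlong, Derivation.add_apply, Derivation.smul_apply, Pi.add_apply,
    Pi.smul_apply, smul_eq_mul, MvPolynomial.smul_eq_C_mul, map_add, map_mul]
  ring

theorem prolongRing_symm (A : (Fin 2 → K) ≃ᵃ[K] (Fin 2 → K)) (c : Kˣ) (P : JetRing K) :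
    prolongRing A.symm c⁻¹ (prolongRing A c P) = P := by
  suffices h : (prolongRing A.symm c⁻¹).comp (prolongRing A c) = AlgHom.id K (JetRing K) from
    DFunLike.congr_fun h P
  have hsymm : ∀ v, A.symm.linear.symm (A.linear.symm v) = v := fun v => by
    change A.linear (A.linear.symm v) = v
    simp
  have hit : ∀ (v : Fin 2 → K) (n : ℕ) (Q : JetRing K),
      prolongRing A.symm c⁻¹ ((totalDerivAlong (A.linear.symm v))^[n] Q) =
        (totalDerivAlong v)^[n] (prolongRing A.symm c⁻¹ Q) := by
    intro v n Q
    induction n with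
    | zero => rfl
    | succ n ih =>
      rw [Function.iterate_succ_apply', Function.iterate_succ_apply',
        prolongRing_totalDerivAlong, ih, hsymm]
  apply MvPolynomial.algHom_ext
  rintro (i | ⟨i, j⟩)
  · have hl : ∀ w : Fin 2 → K, A.linear w i =
        A.linear (Pi.single 0 1) i * w 0 + A.linear (Pi.single 1 1) i * w 1 := by
      intro w
      have hd : w = w 0 • (Pi.single 0 1 : Fin 2 → K) + w 1 • (Pi.single 1 1 : Fin 2 → K) := by
        ext t; fin_cases t <;> simp
      conv_lhs => rw [hd]
      simp
      ring
    have hc : A.linear (A.symm 0) i + A 0 i = 0 := by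
      have h1 : A (A.symm 0) = A.linear (A.symm 0) + A 0 := by
        simpa using A.map_vadd 0 (A.symm 0)
      rw [AffineEquiv.apply_symm_apply] at h1
      exact (congrFun h1 i).symm
    have hs : ∀ l, A.linear (A.symm.linear (Pi.single l 1)) i = (Pi.single l 1 : Fin 2 → K) i := by
      intro l
      change A.linear (A.linear.symm (Pi.single l 1)) i = _
      simp
    have hs0 := hs 0
    have hs1 := hs 1
    rw [hl] at hc hs0 hs1
    have gc := congrArg (MvPolynomial.C (σ := JetVar)) hc
    have g0 := congrArg (MvPolynomial.C (σ := JetVar)) hs0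
    have g1 := congrArg (MvPolynomial.C (σ := JetVar)) hs1
    simp only [map_add, map_mul, map_zero] at gc g0 g1
    have hX : (MvPolynomial.X (Sum.inl i) : JetRing K) =
        MvPolynomial.C ((Pi.single 0 1 : Fin 2 → K) i) * MvPolynomial.X (Sum.inl 0) +
        MvPolynomial.C ((Pi.single 1 1 : Fin 2 → K) i) * MvPolynomial.X (Sum.inl 1) := by
      fin_cases i <;> simp
    rw [AlgHom.id_apply]
    refine Eq.trans ?_ hX.symm
    rw [← g0, ← g1]
    simp only [prolongRing, AlgHom.comp_apply, MvPolynomial.aeval_X, Sum.elim_inl, map_add,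
      map_mul, Fin.sum_univ_two, MvPolynomial.aeval_C, MvPolynomial.algebraMap_eq]
    linear_combination gc
  · have hv : ∀ (k : Fin 2) (a : ℕ),
        (totalDerivAlong (K := K) (Pi.single k 1))^[a] = (totalDeriv k)^[a] := by
      intro k a
      congr 1
      ext P
      fin_cases k <;> simp [totalDerivAlong]
    have hk : ∀ (k : Fin 2) (n : ℕ) (x : K) (Q : JetRing K),
        (totalDeriv k)^[n] (x • Q) = x • (totalDeriv k)^[n] Q := by
      intro k n x Q
      induction n with
      | zero => rfl
      | succ n ih => rw [Function.iterate_succ_apply', Function.iterate_succ_apply', ih,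
          Derivation.map_smul]
    have h1 : ∀ n : ℕ, (totalDeriv (K := K) 1)^[n] (u 0 0) = u 0 n := by
      intro n
      induction n with
      | zero => rfl
      | succ n ih =>
        rw [Function.iterate_succ_apply', ih]
        simp [totalDeriv, u, MvPolynomial.mkDerivation_X]
    have h0 : ∀ n m : ℕ, (totalDeriv (K := K) 0)^[n] (u 0 m) = u n m := by
      intro n m
      induction n with
      | zero => rfl
      | succ n ih =>
        rw [Function.iterate_succ_apply', ih]
        simp [totalDeriv, u, MvPolynomial.mkDerivation_X]
    have hu : prolongRing A.symm c⁻¹ (u 0 0) = ((c⁻¹ : Kˣ) : K) • u 0 0 := by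
      simp [prolongRing, u, MvPolynomial.smul_eq_C_mul]
    change prolongRing A.symm c⁻¹ (prolongRing A c (u i j)) = u i j
    have hX : prolongRing A c (u i j) = (c : K) •
          (totalDerivAlong (A.linear.symm (Pi.single 0 1)))^[i]
            ((totalDerivAlong (A.linear.symm (Pi.single 1 1)))^[j] (u 0 0)) := by
      simp [prolongRing, u, MvPolynomial.smul_eq_C_mul]
    rw [hX, map_smul, hit, hit, hu, hv, hv, hk, hk, smul_smul, h1, h0]
    simp

/-- The pullback of rational functions on the jet spaces along the prolongation of
`f ↦ c · (f ∘ A⁻¹)`. -/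
def prolong (A : (Fin 2 → K) ≃ᵃ[K] (Fin 2 → K)) (c : Kˣ) : JetField K →ₐ[K] JetField K :=
  IsFractionRing.liftAlgHom
    (g := (IsScalarTower.toAlgHom K (JetRing K) (JetField K)).comp (prolongRing A c))
    ((IsFractionRing.injective (JetRing K) (JetField K)).comp
      (Function.LeftInverse.injective (prolongRing_symm A c)))

/-- A rational affine differential invariant: a rational function on the jet spaces which is
invariant under the prolongations of all affine transformations of the plane. -/
def IsAffineInvariant (I : JetField K) : Prop :=
  ∀ A : (Fin 2 → K) ≃ᵃ[K] (Fin 2 → K), prolong A 1 I = I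

/-- A rational affine differential invariant of algebraic curves `P = 0`: it is invariant under all
affine transformations, and under replacing `P` by `c P` with `c ≠ 0`. -/
def IsCurveInvariant (I : JetField K) : Prop :=
  ∀ (A : (Fin 2 → K) ≃ᵃ[K] (Fin 2 → K)) (c : Kˣ), prolong A c I = I

/-- The embedding of polynomial functions into rational functions. -/
abbrev toField : JetRing K →+* JetField K := algebraMap (JetRing K) (JetField K)

/-- The extension of a derivation to rational functions by the quotient rule; see
`fracDeriv_div` for its independence of the chosen numerator and denominator. -/
def fracDeriv (D : Derivation K (JetRing K) (JetRing K)) (f : JetField K) : JetField K :=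
  let a : JetRing K := (IsLocalization.sec (nonZeroDivisors (JetRing K)) f).1
  let b : JetRing K := (IsLocalization.sec (nonZeroDivisors (JetRing K)) f).2
  (toField (D a) * toField b - toField a * toField (D b)) / toField b ^ 2

theorem fracDeriv_div (D : Derivation K (JetRing K) (JetRing K)) (a b : JetRing K) (hb : b ≠ 0) :
    fracDeriv D (toField a / toField b) =
      (toField (D a) * toField b - toField a * toField (D b)) / toField b ^ 2 := by
  have hinj := IsFractionRing.injective (JetRing K) (JetField K)
  have hne : ∀ x : JetRing K, x ≠ 0 → toField x ≠ 0 := fun x hx h =>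
    hx (hinj (by rw [h, map_zero]))
  have hspec := IsLocalization.sec_spec (nonZeroDivisors (JetRing K)) (toField a / toField b)
  unfold fracDeriv
  set s := IsLocalization.sec (nonZeroDivisors (JetRing K)) (toField a / toField b)
  have hd0 : (s.2 : JetRing K) ≠ 0 := nonZeroDivisors.ne_zero s.2.2
  generalize (s.2 : JetRing K) = d at hspec hd0
  generalize s.1 = n at hspec
  have hb' := hne b hb
  have hd' := hne d hd0
  have hpoly : a * d = n * b := by
    apply hinj
    rw [map_mul, map_mul]
    have := hspec
    field_simp at this
    linear_combination this
  have hD := congrArg D hpoly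
  simp only [Derivation.leibniz, smul_eq_mul] at hD
  have e1 := congrArg toField hpoly
  have e2 := congrArg toField hD
  simp only [map_add, map_mul] at e1 e2
  rw [div_eq_div_iff (pow_ne_zero 2 hd') (pow_ne_zero 2 hb')]
  linear_combination (-(toField b * toField d)) * e2 +
    (toField b * toField (D d) + toField d * toField (D b)) * e1

/-- The derivation `γ = ∑ u_{ij} ∂_{u_{ij}}` on polynomial functions. -/
def gamma : Derivation K (JetRing K) (JetRing K) :=
  MvPolynomial.mkDerivation K (Sum.elim (fun _ => 0) (fun ij : ℕ × ℕ => u ij.1 ij.2))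

/-- `I` is of weight `w`: `γ(I) = w I`. -/
def HasWeight (I : JetField K) (w : ℤ) : Prop := fracDeriv gamma I = (w : JetField K) * I

/-- The jet coordinate `u_{ij}` as a rational function. -/
def uf (i j : ℕ) : JetField K := toField (u i j)

/-- The invariant `I_0 = u_{00}`. -/
def I₀ : JetField K := uf 0 0

/-- The invariant `I_2`. -/
def I₂ : JetField K :=
  (uf 0 1 ^ 2 * uf 2 0 - 2 * uf 1 0 * uf 0 1 * uf 1 1 + uf 1 0 ^ 2 * uf 0 2) /
    (uf 2 0 * uf 0 2 - uf 1 1 ^ 2)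

/-- The coframe `ω_1 = d̂ u_{00}`, `ω_2 = d̂ I_2`, where `d̂ f = (df/dx) dx + (df/dy) dy` is the
total differential: row `r` holds the coefficients of `ω_{r+1}` at `dx`, `dy`. -/
def coframe : Matrix (Fin 2) (Fin 2) (JetField K) :=
  Matrix.of fun r j => fracDeriv (totalDeriv j) (if r = 0 then I₀ else I₂)

/-- The horizontal symmetric tensors, as polynomials in `dx` (`X 0`) and `dy` (`X 1`). -/
abbrev SymTensors (K : Type*) [Field K] := MvPolynomial (Fin 2) (JetField K)

/-- The symmetric tensor `Θ_k = ∑_i u_{i,k-i} dx^i/i! dy^{k-i}/(k-i)!`. -/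
def theta (k : ℕ) : SymTensors K :=
  ∑ i ∈ Finset.range (k + 1),
    MvPolynomial.C (uf i (k - i) / ((i.factorial : JetField K) * ((k - i).factorial : JetField K)))
      * MvPolynomial.X 0 ^ i * MvPolynomial.X 1 ^ (k - i)

/-- The 1-forms `ω_1` (`r = 0`) and `ω_2` (`r = 1`) as horizontal tensors. -/
def omega (r : Fin 2) : SymTensors K :=
  ∑ j : Fin 2, MvPolynomial.C (coframe r j) * MvPolynomial.X j

/-- The expression of a symmetric tensor through the coframe: `dx`, `dy` are replaced by
their expressions through `ω_1`, `ω_2`, which are the variables (`X 0`, `X 1`) of the result. -/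
def inCoframe : SymTensors K →ₐ[JetField K] SymTensors K :=
  MvPolynomial.aeval fun j => ∑ r : Fin 2, MvPolynomial.C (coframe⁻¹ j r) * MvPolynomial.X r

/-- The invariants `I_{ij}`, i.e. the coefficients in
`Θ_k = ∑_i I_{i,k-i} ω_1^i/i! ω_2^{k-i}/(k-i)!`; see `theta_eq`. -/
def tensorInvariant (i j : ℕ) : JetField K :=
  (i.factorial : JetField K) * (j.factorial : JetField K) *
    MvPolynomial.coeff (Finsupp.single 0 i + Finsupp.single 1 j) (inCoframe (theta (i + j)))

theorem isUnit_det_coframe : IsUnit (coframe (K := K)).det := by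
  have hinj := IsFractionRing.injective (JetRing K) (JetField K)
  have hne : ∀ x : JetRing K, x ≠ 0 → toField x ≠ 0 := fun x hx h =>
    hx (hinj (by rw [h, map_zero]))
  let pt : JetVar → K := Sum.elim (fun _ => 0) (fun ij =>
    if ij = (1, 0) ∨ ij = (2, 0) ∨ ij = (0, 2) ∨ ij = (2, 1) then 1 else 0)
  let ev : JetRing K →+* K := MvPolynomial.eval pt
  have hev : ∀ x : JetRing K, ev x ≠ 0 → x ≠ 0 := fun x hx h => hx (by rw [h, map_zero])
  set N : JetRing K := u 0 1 ^ 2 * u 2 0 - 2 * u 1 0 * u 0 1 * u 1 1 + u 1 0 ^ 2 * u 0 2 with hN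
  set H : JetRing K := u 2 0 * u 0 2 - u 1 1 ^ 2 with hH
  have hu : ∀ i j, ev (u i j) =
      if (i, j) = (1, 0) ∨ (i, j) = (2, 0) ∨ (i, j) = (0, 2) ∨ (i, j) = (2, 1) then 1 else 0 := by
    intro i j
    simp [ev, pt, u]
  have hH1 : ev H = 1 := by simp [hH, hu]
  have hH0 : toField H ≠ 0 := hne _ (hev _ (by rw [hH1]; exact one_ne_zero))
  have hI2 : (I₂ : JetField K) = toField N / toField H := by
    have h2 : toField (K := K) 2 = 2 := map_ofNat _ 2
    simp [I₂, uf, hN, hH, h2]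
  have hI0 : (I₀ : JetField K) = toField (u 0 0) / toField 1 := by
    simp [I₀, uf]
  have d0 : ∀ i j, totalDeriv (K := K) 0 (u i j) = u (i + 1) j := fun i j => by
    simp [totalDeriv, u, MvPolynomial.mkDerivation_X]
  have d1 : ∀ i j, totalDeriv (K := K) 1 (u i j) = u i (j + 1) := fun i j => by
    simp [totalDeriv, u, MvPolynomial.mkDerivation_X]
  have hdet : (coframe (K := K)).det = toField
      (u 1 0 * (totalDeriv 1 N * H - N * totalDeriv 1 H) -
        u 0 1 * (totalDeriv 0 N * H - N * totalDeriv 0 H)) / toField H ^ 2 := by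
    rw [Matrix.det_fin_two]
    simp only [coframe, Matrix.of_apply, if_true, one_ne_zero, if_false]
    rw [hI0, hI2, fracDeriv_div _ _ _ one_ne_zero, fracDeriv_div _ _ _ one_ne_zero,
      fracDeriv_div _ _ _ (hev _ (by rw [hH1]; exact one_ne_zero)),
      fracDeriv_div _ _ _ (hev _ (by rw [hH1]; exact one_ne_zero)), d0, d1]
    simp only [map_sub, map_mul, map_one, Derivation.map_one_eq_zero, map_zero]
    field_simp
    ring
  rw [hdet, isUnit_iff_ne_zero]
  refine div_ne_zero (hne _ (hev _ ?_)) (pow_ne_zero 2 hH0)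
  have h2 : ∀ k, totalDeriv (K := K) k 2 = 0 := fun k => by
    simpa using Derivation.map_natCast (totalDeriv (K := K) k) 2
  simp only [hN, hH, map_add, map_sub, map_mul, Derivation.leibniz, Derivation.leibniz_pow,
    smul_eq_mul, nsmul_eq_mul, map_pow, d0, d1, h2, hu, map_natCast, map_ofNat]
  simp

/-- The defining expansion of the `I_{ij}`. -/
theorem theta_eq [CharZero K] (k : ℕ) :
    theta (K := K) k = ∑ i ∈ Finset.range (k + 1),
      MvPolynomial.C (tensorInvariant i (k - i) /
        ((i.factorial : JetField K) * ((k - i).factorial : JetField K)))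
      * omega 0 ^ i * omega 1 ^ (k - i) := by
  have : CharZero (JetField K) := charZero_of_injective_algebraMap (algebraMap K _).injective
  have hback : ∀ P : SymTensors K, MvPolynomial.aeval omega (inCoframe P) = P := by
    intro P
    suffices h : (MvPolynomial.aeval (R := JetField K) (omega (K := K))).comp inCoframe =
        AlgHom.id _ _ from DFunLike.congr_fun h P
    apply MvPolynomial.algHom_ext
    intro j
    have hm := Matrix.nonsing_inv_mul (coframe (K := K)) isUnit_det_coframe
    have hm' : ∀ l, coframe⁻¹ j 0 * coframe (K := K) 0 l + coframe⁻¹ j 1 * coframe (K := K) 1 l =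
        (1 : Matrix (Fin 2) (Fin 2) (JetField K)) j l := by
      intro l
      rw [← hm, Matrix.mul_apply, Fin.sum_univ_two]
    have h0 := congrArg (MvPolynomial.C (σ := Fin 2)) (hm' 0)
    have h1 := congrArg (MvPolynomial.C (σ := Fin 2)) (hm' 1)
    simp only [map_add, map_mul] at h0 h1
    simp only [inCoframe, AlgHom.comp_apply, MvPolynomial.aeval_X, Fin.sum_univ_two, map_add,
      map_mul, MvPolynomial.aeval_C, MvPolynomial.algebraMap_eq, omega, AlgHom.id_apply]
    have e : (MvPolynomial.X j : SymTensors K) =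
        MvPolynomial.C ((1 : Matrix (Fin 2) (Fin 2) (JetField K)) j 0) * MvPolynomial.X 0 +
        MvPolynomial.C ((1 : Matrix (Fin 2) (Fin 2) (JetField K)) j 1) * MvPolynomial.X 1 := by
      rcases (by omega : j = 0 ∨ j = 1) with rfl | rfl <;> simp
    rw [e, ← h0, ← h1]
    ring
  have hhom : (inCoframe (theta (K := K) k)).IsHomogeneous k := by
    have hlin : ∀ j, (∑ r : Fin 2, MvPolynomial.C (coframe⁻¹ j r) * MvPolynomial.X r :
        SymTensors K).IsHomogeneous 1 := fun j =>
      MvPolynomial.IsHomogeneous.sum _ _ _ fun r _ => by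
        simpa using (MvPolynomial.isHomogeneous_C (Fin 2) (coframe⁻¹ j r)).mul
          (MvPolynomial.isHomogeneous_X (JetField K) r)
    rw [theta, map_sum]
    refine MvPolynomial.IsHomogeneous.sum _ _ _ fun i hi => ?_
    have hik : i + (k - i) = k := by have := Finset.mem_range.mp hi; omega
    have := ((MvPolynomial.isHomogeneous_C (Fin 2) (uf i (k - i) /
      ((i.factorial : JetField K) * ((k - i).factorial : JetField K)))).mul
        ((hlin 0).pow i)).mul ((hlin 1).pow (k - i))
    simp only [map_mul, map_pow, inCoframe, MvPolynomial.aeval_X, MvPolynomial.aeval_C,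
      MvPolynomial.algebraMap_eq]
    convert this using 1
    omega
  have hexp : inCoframe (theta (K := K) k) = ∑ i ∈ Finset.range (k + 1),
      MvPolynomial.C (tensorInvariant i (k - i) /
        ((i.factorial : JetField K) * ((k - i).factorial : JetField K)))
      * MvPolynomial.X 0 ^ i * MvPolynomial.X 1 ^ (k - i) := by
    ext m
    have hterm : ∀ i ∈ Finset.range (k + 1), MvPolynomial.coeff m
        (MvPolynomial.C (tensorInvariant i (k - i) /
          ((i.factorial : JetField K) * ((k - i).factorial : JetField K)))
          * MvPolynomial.X 0 ^ i * MvPolynomial.X 1 ^ (k - i) : SymTensors K) =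
        if i = m 0 ∧ k - i = m 1 then MvPolynomial.coeff m (inCoframe (theta (K := K) k))
          else 0 := by
      intro i hi
      have hik : i + (k - i) = k := by have := Finset.mem_range.mp hi; omega
      have hmon : (MvPolynomial.C (tensorInvariant i (k - i) /
          ((i.factorial : JetField K) * ((k - i).factorial : JetField K)))
          * MvPolynomial.X 0 ^ i * MvPolynomial.X 1 ^ (k - i) : SymTensors K) =
          MvPolynomial.monomial (Finsupp.single 0 i + Finsupp.single 1 (k - i))
            (MvPolynomial.coeff (Finsupp.single 0 i + Finsupp.single 1 (k - i))
              (inCoframe (theta (K := K) k))) := by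
        rw [MvPolynomial.X_pow_eq_monomial, MvPolynomial.X_pow_eq_monomial, mul_assoc,
          MvPolynomial.monomial_mul, MvPolynomial.C_mul_monomial, tensorInvariant, hik]
        congr 1
        have h1 : (i.factorial : JetField K) ≠ 0 := Nat.cast_ne_zero.mpr i.factorial_ne_zero
        have h2 : ((k - i).factorial : JetField K) ≠ 0 :=
          Nat.cast_ne_zero.mpr (k - i).factorial_ne_zero
        field_simp
      have heq : (Finsupp.single 0 i + Finsupp.single 1 (k - i) : Fin 2 →₀ ℕ) = m ↔
          i = m 0 ∧ k - i = m 1 := by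
        rw [Finsupp.ext_iff, Fin.forall_fin_two]
        simp
      rw [hmon, MvPolynomial.coeff_monomial]
      simp only [heq]
      split_ifs with h
      · rw [heq.mpr h]
      · rfl
    rw [MvPolynomial.coeff_sum, Finset.sum_congr rfl hterm]
    by_cases hm : m 0 + m 1 = k
    · rw [Finset.sum_eq_single (m 0)]
      · rw [if_pos ⟨rfl, by omega⟩]
      · intro b _ hb
        rw [if_neg fun h => hb h.1]
      · intro h
        exact absurd (Finset.mem_range.mpr (by omega)) h
    · rw [Finset.sum_eq_zero]
      · by_contra hc
        have := hhom hc
        rw [Finsupp.weight_apply, Finsupp.sum_fintype _ _ (by simp), Fin.sum_univ_two] at this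
        simp at this
        exact hm this
      · intro i hi
        have := Finset.mem_range.mp hi
        rw [if_neg]
        omega
  conv_lhs => rw [← hback (theta k), hexp]
  simp only [map_sum, map_mul, map_pow, MvPolynomial.aeval_X, MvPolynomial.aeval_C,
    MvPolynomial.algebraMap_eq]

end

end AffineJets

/-!
A change of frame acts on jets linearly: if `z i j` are the partial derivatives of a function at a
point and `jetFunctional z` is the functional `X ^ i * Y ^ j ↦ z i j` on `S[X, Y]`, the derivatives
with respect to the frame given by the columns of `M` are the values of this functional on
`(M X) ^ i * (M Y) ^ j`. This is `frameJet c M z`, up to a factor `c`. The prolongation of an affine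
transformation has this form on the coordinates `u_{ij}` (`prolong_uf`), with `M` the inverse of the
linear part, and the `I_{ij}` have it as well, with `M` the inverse of the coframe
(`tensorInvariant_eq_frameJet`). The latter is a statement on the coefficients of `Θ_k` after a
linear substitution; it follows from the invariance of the apolar pairing `p(∂) q |₀`
(`apolar_changeFrame_transpose`). After rescaling, the functions `I_{ij} I_0 ^ (i + j - 1)` are the
coordinates of the jet `frameJet I₀⁻¹ normalFrame uf`.

These functions are invariant because `I_0` and `I_2` are multiplied by `c`. Hence the coframe is
multiplied by `c` and, from the right, by the inverse of the linear part, the matrix that acts on the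
`u_{ij}`; by the composition law `frameJet_frameJet` the two occurrences of this matrix cancel
(`prolong_normalInvariant`).

Conversely, let `I` be invariant. Translations remove the base coordinates from `I`
(`exists_jetEval_div_of_isAffineInvariant`). Invariance under all `(c, M)` over the infinite field
`K` is a polynomial identity in `(c, M)`, so it may be specialized to `c = I_0⁻¹` and
`M = normalFrame`, whose entries are rational functions on the jets. The result expresses `I`
through the functions `I_{ij} I_0 ^ (i + j - 1)`, provided that the denominator survives the
specialization; it does so after `I` is replaced by its pullback, which is `I` again, along a
general transformation over `K` (`exists_eq_jetEval_div`).

The weight condition is the infinitesimal form of invariance under `u_{ij} ↦ T u_{ij}`: if `a / b`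
has weight zero, the polynomials in `T` obtained from `a` and `b` have equal logarithmic derivatives,
so in characteristic zero they are proportional (`mul_C_eval_eq_of_derivative_mul_eq`).
-/

namespace AffineJets

noncomputable section

open MvPolynomial

/-! ### Linear changes of frame acting on jets -/

section Frame

variable {S S' : Type*} [CommRing S] [CommRing S']

/-- The linear functional on `S[X, Y]` with `X ^ i * Y ^ j ↦ z i j`. When `z i j` are the partial
derivatives of a function at a point, it applies a constant-coefficient differential operator to
that function and evaluates at the point. -/
def jetFunctional (z : ℕ → ℕ → S) : MvPolynomial (Fin 2) S →ₗ[S] S :=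
  (basisMonomials (Fin 2) S).constr S fun m => z (m 0) (m 1)

theorem jetFunctional_monomial (z : ℕ → ℕ → S) (m : Fin 2 →₀ ℕ) (a : S) :
    jetFunctional z (monomial m a) = a * z (m 0) (m 1) := by
  have h : monomial m a = a • basisMonomials (Fin 2) S m := by
    rw [coe_basisMonomials, smul_monomial, smul_eq_mul, mul_one]
  rw [h, map_smul, jetFunctional, Module.Basis.constr_basis, smul_eq_mul]

theorem X_pow_mul_X_pow (i j : ℕ) : (X 0 ^ i * X 1 ^ j : MvPolynomial (Fin 2) S) =
    monomial (Finsupp.single 0 i + Finsupp.single 1 j) 1 := by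
  rw [X_pow_eq_monomial, X_pow_eq_monomial, monomial_mul, mul_one]

theorem monomial_fin_two (m : Fin 2 →₀ ℕ) (a : S) :
    monomial m a = C a * (X 0 ^ m 0 * X 1 ^ m 1) := by
  rw [monomial_eq, Finsupp.prod_fintype _ _ (fun _ => pow_zero _), Fin.prod_univ_two]

theorem jetFunctional_X_pow (z : ℕ → ℕ → S) (i j : ℕ) :
    jetFunctional z (X 0 ^ i * X 1 ^ j) = z i j := by
  rw [X_pow_mul_X_pow, jetFunctional_monomial]
  simp

theorem jetFunctional_C_mul (z : ℕ → ℕ → S) (a : S) (p : MvPolynomial (Fin 2) S) :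
    jetFunctional z (C a * p) = a * jetFunctional z p := by
  rw [← smul_eq_C_mul, map_smul, smul_eq_mul]

theorem map_jetFunctional (f : S →+* S') (z : ℕ → ℕ → S) (p : MvPolynomial (Fin 2) S) :
    f (jetFunctional z p) = jetFunctional (fun i j => f (z i j)) (map f p) := by
  induction p using MvPolynomial.induction_on' with
  | monomial m a => rw [map_monomial, jetFunctional_monomial, jetFunctional_monomial, map_mul]
  | add p q hp hq => simp only [map_add, hp, hq]

/-- The linear form whose coefficients are the `k`-th column of `M`. -/
def columnForm (M : Matrix (Fin 2) (Fin 2) S) (k : Fin 2) : MvPolynomial (Fin 2) S :=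
  ∑ l, C (M l k) * X l

/-- The substitution that replaces the `k`-th variable by the linear form of the `k`-th column
of `M`. -/
def changeFrame (M : Matrix (Fin 2) (Fin 2) S) :
    MvPolynomial (Fin 2) S →ₐ[S] MvPolynomial (Fin 2) S :=
  aeval (columnForm M)

theorem changeFrame_X (M : Matrix (Fin 2) (Fin 2) S) (k : Fin 2) :
    changeFrame M (X k) = columnForm M k := aeval_X _ _

theorem changeFrame_changeFrame (M N : Matrix (Fin 2) (Fin 2) S) (p : MvPolynomial (Fin 2) S) :
    changeFrame M (changeFrame N p) = changeFrame (M * N) p := by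
  suffices h : (changeFrame M).comp (changeFrame N) = changeFrame (M * N) from
    DFunLike.congr_fun h p
  refine algHom_ext fun k => ?_
  simp only [AlgHom.comp_apply, changeFrame_X, columnForm, Fin.sum_univ_two, map_add, map_mul,
    algHom_C, algebraMap_eq, Matrix.mul_apply]
  ring

theorem changeFrame_one (p : MvPolynomial (Fin 2) S) : changeFrame 1 p = p := by
  suffices h : changeFrame (1 : Matrix (Fin 2) (Fin 2) S) = AlgHom.id S _ from
    DFunLike.congr_fun h p
  refine algHom_ext fun k => ?_
  rw [changeFrame_X, columnForm, AlgHom.id_apply]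
  simp [Matrix.one_apply]

theorem map_columnForm (f : S →+* S') (M : Matrix (Fin 2) (Fin 2) S) (k : Fin 2) :
    map f (columnForm M k) = columnForm (M.map f) k := by
  simp [columnForm]

theorem changeFrame_X_pow (M : Matrix (Fin 2) (Fin 2) S) (i j : ℕ) :
    changeFrame M (X 0 ^ i * X 1 ^ j) = columnForm M 0 ^ i * columnForm M 1 ^ j := by
  rw [map_mul, map_pow, map_pow, changeFrame_X, changeFrame_X]

/-- The partial derivatives of order `(i, j)` with respect to the frame of vectors formed by the
columns of `M`, expressed through the partial derivatives `z`, and multiplied by `c`. -/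
def frameJet (c : S) (M : Matrix (Fin 2) (Fin 2) S) (z : ℕ → ℕ → S) (i j : ℕ) : S :=
  c * jetFunctional z (changeFrame M (X 0 ^ i * X 1 ^ j))

theorem jetFunctional_frameJet (c : S) (M : Matrix (Fin 2) (Fin 2) S) (z : ℕ → ℕ → S)
    (p : MvPolynomial (Fin 2) S) :
    jetFunctional (frameJet c M z) p = c * jetFunctional z (changeFrame M p) := by
  induction p using MvPolynomial.induction_on' with
  | monomial m a =>
    rw [monomial_fin_two, jetFunctional_C_mul, jetFunctional_X_pow, map_mul, algHom_C,
      algebraMap_eq, jetFunctional_C_mul, frameJet]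
    ring
  | add p q hp hq => simp only [map_add, hp, hq, mul_add]

theorem frameJet_frameJet (c d : S) (M N : Matrix (Fin 2) (Fin 2) S) (z : ℕ → ℕ → S) :
    frameJet d N (frameJet c M z) = frameJet (d * c) (M * N) z := by
  funext i j
  rw [frameJet, jetFunctional_frameJet, changeFrame_changeFrame, frameJet, mul_assoc]

theorem frameJet_one (z : ℕ → ℕ → S) : frameJet 1 1 z = z := by
  funext i j
  rw [frameJet, changeFrame_one, jetFunctional_X_pow, one_mul]

theorem frameJet_smul_frame (c t : S) (M : Matrix (Fin 2) (Fin 2) S) (z : ℕ → ℕ → S) (i j : ℕ) :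
    frameJet c (t • M) z i j = c * t ^ (i + j) * jetFunctional z (changeFrame M (X 0 ^ i * X 1 ^ j))
    := by
  have h : ∀ k, columnForm (t • M) k = C t * columnForm M k := fun k => by
    simp only [columnForm, Fin.sum_univ_two, Matrix.smul_apply, smul_eq_mul, map_mul]
    ring
  have h2 : columnForm (t • M) 0 ^ i * columnForm (t • M) 1 ^ j =
      C (t ^ (i + j)) * (columnForm M 0 ^ i * columnForm M 1 ^ j) := by
    rw [h, h, map_pow]
    ring
  rw [frameJet, changeFrame_X_pow, changeFrame_X_pow, h2, jetFunctional_C_mul, mul_assoc]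

theorem map_frameJet (f : S →+* S') (c : S) (M : Matrix (Fin 2) (Fin 2) S) (z : ℕ → ℕ → S)
    (i j : ℕ) : f (frameJet c M z i j) =
      frameJet (f c) (M.map f) (fun a b => f (z a b)) i j := by
  rw [frameJet, frameJet, map_mul, map_jetFunctional, changeFrame_X_pow, changeFrame_X_pow, map_mul,
    map_pow, map_pow, map_columnForm, map_columnForm]

end Frame

/-! ### The apolar pairing -/

section Apolar

variable {S : Type*} [CommRing S]

/-- The apolar pairing `p(∂) q |₀` of polynomials in two variables, as a functional of `p`. -/
def apolar (q : MvPolynomial (Fin 2) S) : MvPolynomial (Fin 2) S →ₗ[S] S :=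
  jetFunctional fun i j => (i.factorial : S) * (j.factorial : S) *
    coeff (Finsupp.single 0 i + Finsupp.single 1 j) q

theorem single_add_single_fin_two (m : Fin 2 →₀ ℕ) :
    Finsupp.single 0 (m 0) + Finsupp.single 1 (m 1) = m := by
  ext k
  rcases (by omega : k = 0 ∨ k = 1) with rfl | rfl <;> simp

theorem apolar_monomial (q : MvPolynomial (Fin 2) S) (m : Fin 2 →₀ ℕ) (a : S) :
    apolar q (monomial m a) =
      a * (((m 0).factorial : S) * ((m 1).factorial : S) * coeff m q) := by
  rw [apolar, jetFunctional_monomial, single_add_single_fin_two]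

theorem apolar_add (q r p : MvPolynomial (Fin 2) S) :
    apolar (q + r) p = apolar q p + apolar r p := by
  induction p using MvPolynomial.induction_on' with
  | monomial m a => simp only [apolar_monomial, coeff_add]; ring
  | add p q hp hq => simp only [map_add, hp, hq]; ring

theorem apolar_C_mul (a : S) (q p : MvPolynomial (Fin 2) S) :
    apolar (C a * q) p = a * apolar q p := by
  induction p using MvPolynomial.induction_on' with
  | monomial m a => simp only [apolar_monomial, coeff_C_mul]; ring
  | add p q hp hq => simp only [map_add, hp, hq]; ring

/-- Multiplication by a variable is adjoint to the corresponding partial derivative. -/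
theorem apolar_mul_X (q p : MvPolynomial (Fin 2) S) (k : Fin 2) :
    apolar q (p * X k) = apolar (pderiv k q) p := by
  induction p using MvPolynomial.induction_on' with
  | monomial m a =>
    rw [X, monomial_mul, apolar_monomial, apolar_monomial, coeff_pderiv]
    rcases (by omega : k = 0 ∨ k = 1) with rfl | rfl <;>
      simp [Nat.factorial_succ] <;> ring
  | add p q hp hq => simp only [map_add, add_mul, hp, hq]

theorem pderiv_changeFrame_transpose (M : Matrix (Fin 2) (Fin 2) S) (k : Fin 2)
    (q : MvPolynomial (Fin 2) S) :
    pderiv k (changeFrame M.transpose q) =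
      C (M 0 k) * changeFrame M.transpose (pderiv 0 q) +
        C (M 1 k) * changeFrame M.transpose (pderiv 1 q) := by
  induction q using MvPolynomial.induction_on with
  | C a => simp [algHom_C]
  | add p q hp hq => simp only [map_add, hp, hq]; ring
  | mul_X p l hp =>
    simp only [map_mul, Derivation.leibniz, hp, smul_eq_mul, map_add, changeFrame_X, columnForm,
      Fin.sum_univ_two, Matrix.transpose_apply, pderiv_X, pderiv_C]
    rcases (by omega : k = 0 ∨ k = 1) with rfl | rfl <;>
      rcases (by omega : l = 0 ∨ l = 1) with rfl | rfl <;> simp <;> ring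

/-- For the apolar pairing, substitutions by a matrix and by its transpose are adjoint. -/
theorem apolar_changeFrame_transpose (M : Matrix (Fin 2) (Fin 2) S)
    (q p : MvPolynomial (Fin 2) S) :
    apolar (changeFrame M.transpose q) p = apolar q (changeFrame M p) := by
  induction p using MvPolynomial.induction_on generalizing q with
  | C a =>
    have h0 : constantCoeff (changeFrame M.transpose q) = constantCoeff q := by
      suffices h : (constantCoeff (σ := Fin 2)).comp
          (changeFrame M.transpose : _ →ₐ[S] _).toRingHom = constantCoeff from
        DFunLike.congr_fun h q
      refine ringHom_ext (fun r => ?_) fun k => ?_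
      · simp [algHom_C]
      · simp [changeFrame_X, columnForm]
    rw [algHom_C, algebraMap_eq, C_apply, apolar_monomial, apolar_monomial]
    rw [constantCoeff_eq] at h0
    rw [h0]
  | add p q hp hq => simp only [map_add, hp, hq]
  | mul_X p k hp =>
    have h : changeFrame M (p * X k) = C (M 0 k) * (changeFrame M p * X 0) +
        C (M 1 k) * (changeFrame M p * X 1) := by
      rw [map_mul, changeFrame_X, columnForm, Fin.sum_univ_two]
      ring
    rw [apolar_mul_X, pderiv_changeFrame_transpose, apolar_add, apolar_C_mul, apolar_C_mul, hp, hp,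
      h, map_add, ← smul_eq_C_mul, ← smul_eq_C_mul, map_smul, map_smul, apolar_mul_X, apolar_mul_X,
      smul_eq_mul, smul_eq_mul]

end Apolar

/-! ### Prolonged transformations as changes of frame -/

section Prolong

variable {K : Type*} [Field K]

theorem toField_injective : Function.Injective (toField (K := K)) :=
  IsFractionRing.injective (JetRing K) (JetField K)

theorem toField_ne_zero {a : JetRing K} (ha : a ≠ 0) : toField a ≠ 0 := fun h =>
  ha (toField_injective (by rw [h, map_zero]))

theorem exists_toField_div (I : JetField K) :
    ∃ a b : JetRing K, b ≠ 0 ∧ I = toField a / toField b := by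
  obtain ⟨a, b, hb, h⟩ := IsFractionRing.div_surjective (JetRing K) I
  exact ⟨a, b, nonZeroDivisors.ne_zero hb, h.symm⟩

theorem toField_C (a : K) : toField (C a) = algebraMap K (JetField K) a :=
  (IsScalarTower.algebraMap_apply K (JetRing K) (JetField K) a).symm

theorem totalDeriv_zero_u (i j : ℕ) : totalDeriv (K := K) 0 (u i j) = u (i + 1) j := by
  simp [totalDeriv, u, mkDerivation_X]

theorem totalDeriv_one_u (i j : ℕ) : totalDeriv (K := K) 1 (u i j) = u i (j + 1) := by
  simp [totalDeriv, u, mkDerivation_X]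

theorem totalDeriv_jetFunctional (k : Fin 2) (p : MvPolynomial (Fin 2) K) :
    totalDeriv k (jetFunctional u (map C p)) = jetFunctional u (map C (p * X k)) := by
  induction p using MvPolynomial.induction_on' with
  | monomial m a =>
    rw [X, monomial_mul, map_monomial, map_monomial, jetFunctional_monomial,
      jetFunctional_monomial, ← smul_eq_C_mul, Derivation.map_smul]
    rcases (by omega : k = 0 ∨ k = 1) with rfl | rfl
    · simp [totalDeriv_zero_u, smul_eq_C_mul]
    · simp [totalDeriv_one_u, smul_eq_C_mul]
  | add p q hp hq => simp only [map_add, add_mul, hp, hq]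

theorem totalDerivAlong_iterate_jetFunctional (M : Matrix (Fin 2) (Fin 2) K) (k : Fin 2) (n : ℕ)
    (p : MvPolynomial (Fin 2) K) :
    (totalDerivAlong fun l => M l k)^[n] (jetFunctional u (map C p)) =
      jetFunctional u (map C (p * columnForm M k ^ n)) := by
  induction n with
  | zero => rw [pow_zero, mul_one]; rfl
  | succ n ih =>
    have h : p * columnForm M k ^ (n + 1) = C (M 0 k) * (p * columnForm M k ^ n * X 0) +
        C (M 1 k) * (p * columnForm M k ^ n * X 1) := by
      rw [pow_succ]
      nth_rw 2 [columnForm]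
      rw [Fin.sum_univ_two]
      ring
    rw [Function.iterate_succ_apply', ih, h, totalDerivAlong, Derivation.add_apply,
      Derivation.smul_apply, Derivation.smul_apply, totalDeriv_jetFunctional,
      totalDeriv_jetFunctional, map_add, map_add, map_mul (map C) (C (M 0 k)),
      map_mul (map C) (C (M 1 k)), map_C, map_C, jetFunctional_C_mul, jetFunctional_C_mul,
      smul_eq_C_mul, smul_eq_C_mul]

/-- The matrix of the inverse of the linear part of an affine transformation. -/
def invLinear (A : (Fin 2 → K) ≃ᵃ[K] (Fin 2 → K)) : Matrix (Fin 2) (Fin 2) K :=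
  Matrix.of fun l k => A.linear.symm (Pi.single k 1) l

theorem invLinear_eq_toMatrix' (A : (Fin 2 → K) ≃ᵃ[K] (Fin 2 → K)) :
    invLinear A = LinearMap.toMatrix' (A.linear.symm : (Fin 2 → K) →ₗ[K] (Fin 2 → K)) := by
  ext l k
  simp [invLinear, LinearMap.toMatrix'_apply]

theorem isUnit_det_invLinear (A : (Fin 2 → K) ≃ᵃ[K] (Fin 2 → K)) : IsUnit (invLinear A).det := by
  rw [invLinear_eq_toMatrix', LinearMap.det_toMatrix']
  exact LinearEquiv.isUnit_det' A.linear.symm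

theorem prolongRing_u (A : (Fin 2 → K) ≃ᵃ[K] (Fin 2 → K)) (c : Kˣ) (i j : ℕ) :
    prolongRing A c (u i j) = frameJet (C (c : K)) ((invLinear A).map C) u i j := by
  have h0 : u 0 0 = jetFunctional (u (K := K)) (map C (1 : MvPolynomial (Fin 2) K)) := by
    rw [map_one]
    simpa using (jetFunctional_X_pow (u (K := K)) 0 0).symm
  have h1 : prolongRing A c (u i j) = C (c : K) *
      (totalDerivAlong fun l => invLinear A l 0)^[i]
        ((totalDerivAlong fun l => invLinear A l 1)^[j] (u 0 0)) := by
    simp [prolongRing, u, invLinear]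
  rw [h1, h0, totalDerivAlong_iterate_jetFunctional, totalDerivAlong_iterate_jetFunctional,
    frameJet, changeFrame_X_pow]
  simp only [map_mul, map_pow, map_columnForm, one_mul]
  rw [mul_comm (columnForm _ _ ^ j)]

theorem prolong_toField (A : (Fin 2 → K) ≃ᵃ[K] (Fin 2 → K)) (c : Kˣ) (P : JetRing K) :
    prolong A c (toField P) = toField (prolongRing A c P) :=
  IsFractionRing.lift_algebraMap
    (g := ((IsScalarTower.toAlgHom K (JetRing K) (JetField K)).comp
      (prolongRing A c) : JetRing K →+* JetField K))
    (toField_injective.comp (Function.LeftInverse.injective (prolongRing_symm A c))) P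

theorem prolongRing_ne_zero (A : (Fin 2 → K) ≃ᵃ[K] (Fin 2 → K)) (c : Kˣ) {P : JetRing K}
    (hP : P ≠ 0) : prolongRing A c P ≠ 0 := fun h =>
  hP ((Function.LeftInverse.injective (prolongRing_symm A c)) (by rw [h, map_zero]))

/-- The matrix of the inverse of the linear part of an affine transformation, over the field of
rational functions on the jets. -/
def invLinearField (A : (Fin 2 → K) ≃ᵃ[K] (Fin 2 → K)) :
    Matrix (Fin 2) (Fin 2) (JetField K) :=
  (invLinear A).map (algebraMap K (JetField K))

theorem isUnit_det_invLinearField (A : (Fin 2 → K) ≃ᵃ[K] (Fin 2 → K)) :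
    IsUnit (invLinearField A).det := by
  have h := (isUnit_det_invLinear A).map (algebraMap K (JetField K))
  rwa [RingHom.map_det] at h

theorem prolong_uf (A : (Fin 2 → K) ≃ᵃ[K] (Fin 2 → K)) (c : Kˣ) (i j : ℕ) :
    prolong A c (uf i j) =
      frameJet (algebraMap K (JetField K) c) (invLinearField A) uf i j := by
  have hM : ((invLinear A).map C).map (toField (K := K)) = invLinearField A := by
    ext l k
    simp only [Matrix.map_apply, toField_C, invLinearField]
  rw [uf, prolong_toField, prolongRing_u, map_frameJet, toField_C, hM]
  rfl

theorem prolong_fracDeriv (A : (Fin 2 → K) ≃ᵃ[K] (Fin 2 → K)) (c : Kˣ) (k : Fin 2)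
    (f : JetField K) :
    prolong A c (fracDeriv (totalDeriv k) f) =
      ∑ l, fracDeriv (totalDeriv l) (prolong A c f) * invLinearField A l k := by
  obtain ⟨a, b, hb, rfl⟩ := exists_toField_div f
  have hb' := prolongRing_ne_zero A c hb
  have hbf := toField_ne_zero hb'
  have hD : ∀ P : JetRing K, toField (prolongRing A c (totalDeriv k P)) =
      ∑ l, toField (totalDeriv l (prolongRing A c P)) * invLinearField A l k := fun P => by
    simp [prolongRing_totalDeriv, totalDerivAlong, Fin.sum_univ_two, invLinearField, invLinear,
      smul_eq_C_mul, toField_C, mul_comm]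
  rw [fracDeriv_div _ _ _ hb, map_div₀ (prolong A c) (toField a), Fin.sum_univ_two]
  simp only [map_div₀ (prolong A c), map_sub, map_mul, map_pow, prolong_toField,
    fracDeriv_div _ _ _ hb', hD, Fin.sum_univ_two]
  field_simp
  ring

theorem fracDeriv_algebraMap_mul (D : Derivation K (JetRing K) (JetRing K)) (c : K)
    (f : JetField K) :
    fracDeriv D (algebraMap K (JetField K) c * f) = algebraMap K (JetField K) c * fracDeriv D f := by
  obtain ⟨a, b, hb, rfl⟩ := exists_toField_div f
  have h : algebraMap K (JetField K) c * (toField a / toField b) =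
      toField (C c * a) / toField b := by
    rw [map_mul, toField_C, mul_div_assoc]
  rw [h, fracDeriv_div _ _ _ hb, fracDeriv_div _ _ _ hb, ← smul_eq_C_mul, Derivation.map_smul,
    smul_eq_C_mul, smul_eq_C_mul, map_mul, map_mul, toField_C]
  ring

end Prolong

/-! ### The functions `I_{ij} I_0 ^ (i + j - 1)` are invariants of curves -/

section Invariants

variable {K : Type*} [Field K]

theorem prolong_I₀ (A : (Fin 2 → K) ≃ᵃ[K] (Fin 2 → K)) (c : Kˣ) :
    prolong A c I₀ = algebraMap K (JetField K) c * I₀ := by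
  rw [I₀, prolong_uf, frameJet, pow_zero, pow_zero, mul_one, map_one]
  congr 1
  simpa using jetFunctional_X_pow (uf (K := K)) 0 0

/-- `I_2` is a quotient of two joint covariants of the first and second derivatives, both of which
are multiplied by the square of the determinant. -/
theorem prolong_I₂ (A : (Fin 2 → K) ≃ᵃ[K] (Fin 2 → K)) (c : Kˣ) :
    prolong A c I₂ = algebraMap K (JetField K) c * I₂ := by
  set M := invLinearField A with hM
  set d := algebraMap K (JetField K) c with hd
  have hd0 : d ≠ 0 := by simp [hd]
  have hdet : M.det ≠ 0 := (isUnit_det_invLinearField A).ne_zero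
  have h1 : ∀ k, columnForm M k = C (M 0 k) * X 0 + C (M 1 k) * X 1 := fun k => by
    rw [columnForm, Fin.sum_univ_two]
  have hlin : ∀ a b : JetField K,
      jetFunctional uf (C a * X 0 + C b * X 1) = a * uf 1 0 + b * uf 0 1 := fun a b => by
    have e0 := jetFunctional_X_pow (uf (K := K)) 1 0
    have e1 := jetFunctional_X_pow (uf (K := K)) 0 1
    rw [pow_zero, pow_one, mul_one] at e0
    rw [pow_zero, pow_one, one_mul] at e1
    rw [map_add, jetFunctional_C_mul, jetFunctional_C_mul, e0, e1]
  have hquad : ∀ a b a' b' : JetField K,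
      jetFunctional uf ((C a * X 0 + C b * X 1) * (C a' * X 0 + C b' * X 1)) =
        a * a' * uf 2 0 + (a * b' + b * a') * uf 1 1 + b * b' * uf 0 2 := fun a b a' b' => by
    have e : ((C a * X 0 + C b * X 1) * (C a' * X 0 + C b' * X 1) : SymTensors K) =
        C (a * a') * (X 0 ^ 2 * X 1 ^ 0) + C (a * b' + b * a') * (X 0 ^ 1 * X 1 ^ 1) +
          C (b * b') * (X 0 ^ 0 * X 1 ^ 2) := by
      simp only [map_add, map_mul]
      ring
    rw [e, map_add, map_add, jetFunctional_C_mul, jetFunctional_C_mul, jetFunctional_C_mul,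
      jetFunctional_X_pow, jetFunctional_X_pow, jetFunctional_X_pow]
  have e10 : prolong A c (uf 1 0) = d * (M 0 0 * uf 1 0 + M 1 0 * uf 0 1) := by
    rw [prolong_uf, frameJet, changeFrame_X_pow, pow_one, pow_zero, mul_one, h1, hlin]
  have e01 : prolong A c (uf 0 1) = d * (M 0 1 * uf 1 0 + M 1 1 * uf 0 1) := by
    rw [prolong_uf, frameJet, changeFrame_X_pow, pow_one, pow_zero, one_mul, h1, hlin]
  have e20 : prolong A c (uf 2 0) = d * (M 0 0 * M 0 0 * uf 2 0 +
      (M 0 0 * M 1 0 + M 1 0 * M 0 0) * uf 1 1 + M 1 0 * M 1 0 * uf 0 2) := by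
    rw [prolong_uf, frameJet, changeFrame_X_pow, pow_two, pow_zero, mul_one, h1, hquad]
  have e11 : prolong A c (uf 1 1) = d * (M 0 0 * M 0 1 * uf 2 0 +
      (M 0 0 * M 1 1 + M 1 0 * M 0 1) * uf 1 1 + M 1 0 * M 1 1 * uf 0 2) := by
    rw [prolong_uf, frameJet, changeFrame_X_pow, pow_one, pow_one, h1, h1, hquad]
  have e02 : prolong A c (uf 0 2) = d * (M 0 1 * M 0 1 * uf 2 0 +
      (M 0 1 * M 1 1 + M 1 1 * M 0 1) * uf 1 1 + M 1 1 * M 1 1 * uf 0 2) := by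
    rw [prolong_uf, frameJet, changeFrame_X_pow, pow_two, pow_zero, one_mul, h1, hquad]
  rw [I₂, map_div₀]
  simp only [map_add, map_sub, map_mul, map_pow, map_ofNat, e10, e01, e20, e11, e02]
  rw [← mul_div_assoc]
  refine Eq.trans ?_ (mul_div_mul_left _ _ (mul_ne_zero (pow_ne_zero 2 hd0)
    (pow_ne_zero 2 hdet)))
  rw [Matrix.det_fin_two]
  congr 1 <;> ring

/-- The coframe is multiplied by the inverse of the linear part, and has weight one. -/
theorem map_coframe_prolong (A : (Fin 2 → K) ≃ᵃ[K] (Fin 2 → K)) (c : Kˣ) :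
    coframe.map (prolong A c) =
      algebraMap K (JetField K) c • (coframe * invLinearField A) := by
  ext r k
  have h : prolong A c (if r = 0 then I₀ else I₂) =
      algebraMap K (JetField K) c * (if r = 0 then I₀ else I₂) := by
    split_ifs
    · exact prolong_I₀ A c
    · exact prolong_I₂ A c
  rw [Matrix.map_apply, Matrix.smul_apply, Matrix.mul_apply, smul_eq_mul, Finset.mul_sum]
  simp only [coframe, Matrix.of_apply]
  rw [prolong_fracDeriv, h]
  refine Finset.sum_congr rfl fun l _ => ?_
  rw [fracDeriv_algebraMap_mul, mul_assoc]

theorem isHomogeneous_columnForm {S : Type*} [CommRing S] (M : Matrix (Fin 2) (Fin 2) S)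
    (k : Fin 2) : (columnForm M k).IsHomogeneous 1 :=
  IsHomogeneous.sum _ _ _ fun l _ => by
    simpa using (isHomogeneous_C (Fin 2) (M l k)).mul (isHomogeneous_X S l)

/-- `Θ_k` is the homogeneous part of degree `k` of the Taylor expansion at the given jet. -/
theorem apolar_theta [CharZero K] (k : ℕ) (p : SymTensors K) (hp : p.IsHomogeneous k) :
    apolar (theta k) p = jetFunctional uf p := by
  have : CharZero (JetField K) := charZero_of_injective_algebraMap (algebraMap K _).injective
  have hcoeff : ∀ m : Fin 2 →₀ ℕ, m 0 + m 1 = k → coeff m (theta (K := K) k) =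
      uf (m 0) (m 1) / (((m 0).factorial : JetField K) * ((m 1).factorial : JetField K)) := by
    intro m hm
    have hm1 : k - m 0 = m 1 := by omega
    rw [theta, coeff_sum, Finset.sum_eq_single (m 0)]
    · rw [mul_assoc, X_pow_mul_X_pow, coeff_C_mul, coeff_monomial, hm1,
        single_add_single_fin_two, if_pos rfl, mul_one]
    · intro i _ hi
      rw [mul_assoc, X_pow_mul_X_pow, coeff_C_mul, coeff_monomial, if_neg, mul_zero]
      rintro rfl
      simp at hi
    · intro h
      exact absurd (Finset.mem_range.mpr (by omega)) h
  rw [← support_sum_monomial_coeff p, map_sum, map_sum]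
  refine Finset.sum_congr rfl fun m hm => ?_
  have hmk : m 0 + m 1 = k := by
    have := hp (mem_support_iff.mp hm)
    rw [Finsupp.weight_apply, Finsupp.sum_fintype _ _ (by simp), Fin.sum_univ_two] at this
    simpa using this
  have h1 : ((m 0).factorial : JetField K) ≠ 0 := Nat.cast_ne_zero.mpr (Nat.factorial_ne_zero _)
  have h2 : ((m 1).factorial : JetField K) ≠ 0 := Nat.cast_ne_zero.mpr (Nat.factorial_ne_zero _)
  rw [apolar_monomial, jetFunctional_monomial, hcoeff m hmk]
  field_simp

/-- `I_{ij}` is the derivative of order `(i, j)` with respect to the frame dual to the coframe. -/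
theorem tensorInvariant_eq_frameJet [CharZero K] (i j : ℕ) :
    tensorInvariant (K := K) i j = frameJet 1 coframe⁻¹ uf i j := by
  have h1 : inCoframe (K := K) = changeFrame (coframe⁻¹).transpose := rfl
  have h2 : tensorInvariant (K := K) i j =
      apolar (inCoframe (theta (i + j))) (X 0 ^ i * X 1 ^ j) := by
    rw [apolar, jetFunctional_X_pow, tensorInvariant]
  have h3 : (changeFrame (coframe (K := K))⁻¹ (X 0 ^ i * X 1 ^ j)).IsHomogeneous (i + j) := by
    rw [changeFrame_X_pow]
    simpa using ((isHomogeneous_columnForm _ 0).pow i).mul ((isHomogeneous_columnForm _ 1).pow j)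
  rw [h2, h1, apolar_changeFrame_transpose, apolar_theta _ _ h3, frameJet, one_mul]

theorem I₀_ne_zero : (I₀ : JetField K) ≠ 0 := toField_ne_zero (X_ne_zero _)

/-- The frame dual to the coframe, rescaled to have weight zero. -/
def normalFrame : Matrix (Fin 2) (Fin 2) (JetField K) := (I₀ : JetField K) • coframe⁻¹

theorem normalInvariant_eq_frameJet [CharZero K] (i j : ℕ) :
    tensorInvariant (K := K) i j * I₀ ^ ((i : ℤ) + (j : ℤ) - 1) =
      frameJet I₀⁻¹ normalFrame uf i j := by
  rw [tensorInvariant_eq_frameJet, normalFrame, frameJet_smul_frame, frameJet, one_mul,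
    zpow_sub_one₀ I₀_ne_zero, ← Nat.cast_add, zpow_natCast]
  ring

theorem prolong_normalInvariant [CharZero K] (A : (Fin 2 → K) ≃ᵃ[K] (Fin 2 → K)) (c : Kˣ)
    (i j : ℕ) :
    prolong A c (tensorInvariant i j * I₀ ^ ((i : ℤ) + (j : ℤ) - 1)) =
      tensorInvariant i j * I₀ ^ ((i : ℤ) + (j : ℤ) - 1) := by
  set d := algebraMap K (JetField K) c with hd
  have hd0 : d ≠ 0 := by simp [hd]
  have hV := isUnit_det_invLinearField A
  have hinv : (coframe⁻¹).map (prolong A c) = d⁻¹ • ((invLinearField A)⁻¹ * coframe⁻¹) := by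
    have h1 : (coframe⁻¹).map (prolong A c) * coframe.map (prolong A c) = 1 := by
      rw [← Matrix.map_mul, Matrix.nonsing_inv_mul _ isUnit_det_coframe]
      exact Matrix.map_one _ (map_zero _) (map_one _)
    rw [map_coframe_prolong] at h1
    rw [← Matrix.inv_eq_left_inv h1]
    refine Matrix.inv_eq_left_inv ?_
    rw [Matrix.smul_mul, Matrix.mul_smul, smul_smul, inv_mul_cancel₀ hd0, one_smul,
      Matrix.mul_assoc, ← Matrix.mul_assoc coframe⁻¹, Matrix.nonsing_inv_mul _ isUnit_det_coframe,
      Matrix.one_mul, Matrix.nonsing_inv_mul _ hV]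
  have hframe : normalFrame.map (prolong A c) = (invLinearField A)⁻¹ * normalFrame := by
    have h : normalFrame.map (prolong A c) = prolong A c I₀ • (coframe⁻¹).map (prolong A c) := by
      ext l k
      simp [normalFrame]
    rw [h, hinv, prolong_I₀, smul_smul, normalFrame, Matrix.mul_smul, ← hd, mul_right_comm,
      mul_inv_cancel₀ hd0, one_mul]
  have huf : (fun a b => prolong A c (uf a b)) = frameJet d (invLinearField A) uf := by
    funext a b
    exact prolong_uf A c a b
  have h := map_frameJet (prolong A c : JetField K →+* JetField K) I₀⁻¹ normalFrame uf i j
  simp only [RingHom.coe_coe] at h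
  rw [normalInvariant_eq_frameJet, h, hframe, huf, frameJet_frameJet, ← Matrix.mul_assoc,
    Matrix.mul_nonsing_inv _ hV, Matrix.one_mul, map_inv₀, prolong_I₀, mul_inv_rev, mul_assoc,
    ← hd, inv_mul_cancel₀ hd0, mul_one]

theorem isCurveInvariant_of_mem_adjoin [CharZero K] {I : JetField K}
    (hI : I ∈ IntermediateField.adjoin K (Set.range fun ij : ℕ × ℕ =>
      (tensorInvariant ij.1 ij.2 * I₀ ^ ((ij.1 : ℤ) + (ij.2 : ℤ) - 1) : JetField K))) :
    IsCurveInvariant I := by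
  intro A c
  induction hI using IntermediateField.adjoin_induction with
  | mem x hx =>
    obtain ⟨ij, rfl⟩ := hx
    exact prolong_normalInvariant A c ij.1 ij.2
  | algebraMap x => exact AlgHom.commutes _ x
  | add x y _ _ hx hy => rw [map_add, hx, hy]
  | inv x _ hx => rw [map_inv₀, hx]
  | mul x y _ _ hx hy => rw [map_mul, hx, hy]

end Invariants

/-! ### Invariants of curves are affine invariants of weight zero -/

section Weight

variable {K : Type*} [Field K]

theorem prolong_div_eq_iff (A : (Fin 2 → K) ≃ᵃ[K] (Fin 2 → K)) (c : Kˣ) {a b : JetRing K}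
    (hb : b ≠ 0) : prolong A c (toField a / toField b) = toField a / toField b ↔
      prolongRing A c a * b = a * prolongRing A c b := by
  rw [map_div₀, prolong_toField, prolong_toField,
    div_eq_div_iff (toField_ne_zero (prolongRing_ne_zero A c hb)) (toField_ne_zero hb), ← map_mul,
    ← map_mul, toField_injective.eq_iff]

theorem hasWeight_zero_div_iff {a b : JetRing K} (hb : b ≠ 0) :
    HasWeight (toField a / toField b) 0 ↔ gamma a * b = a * gamma b := by
  rw [HasWeight, fracDeriv_div _ _ _ hb, Int.cast_zero, zero_mul,
    div_eq_zero_iff, or_iff_left (pow_ne_zero 2 (toField_ne_zero hb)), sub_eq_zero, ← map_mul,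
    ← map_mul, toField_injective.eq_iff]

/-- The substitution `u_{ij} ↦ T * u_{ij}` with a parameter `T`. -/
def scale : JetRing K →ₐ[K] Polynomial (JetRing K) :=
  aeval (Sum.elim (fun i => Polynomial.C (X (Sum.inl i)))
    fun ij => Polynomial.X * Polynomial.C (u ij.1 ij.2))

/-- `γ` is the infinitesimal generator of the scaling of the jet coordinates. -/
theorem X_mul_derivative_scale (P : JetRing K) :
    Polynomial.X * Polynomial.derivative (scale P) = scale (gamma P) := by
  induction P using MvPolynomial.induction_on with
  | C a =>
    rw [← algebraMap_eq, AlgHom.commutes, Derivation.map_algebraMap, map_zero,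
      Polynomial.algebraMap_apply, Polynomial.derivative_C, mul_zero]
  | add p q hp hq => simp only [map_add, mul_add, hp, hq]
  | mul_X p s hp =>
    simp only [map_mul, Derivation.leibniz, smul_eq_mul, map_add, Polynomial.derivative_mul, ← hp]
    rcases s with i | ⟨i, j⟩
    · simp [scale, gamma, mkDerivation_X]
      ring
    · simp [scale, gamma, mkDerivation_X, u]
      ring

theorem prolongRing_refl_X_inl (c : Kˣ) (i : Fin 2) :
    prolongRing (AffineEquiv.refl K (Fin 2 → K)) c (X (Sum.inl i)) = X (Sum.inl i) := by
  simp only [prolongRing, aeval_X, Sum.elim_inl, Fin.sum_univ_two]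
  rcases (by omega : i = 0 ∨ i = 1) with rfl | rfl <;> simp

theorem invLinear_refl : invLinear (AffineEquiv.refl K (Fin 2 → K)) = 1 := by
  ext l k
  simp [invLinear, Matrix.one_apply, Pi.single_apply]

theorem prolongRing_refl_u (c : Kˣ) (i j : ℕ) :
    prolongRing (AffineEquiv.refl K (Fin 2 → K)) c (u i j) = C (c : K) * u i j := by
  rw [prolongRing_u, invLinear_refl, Matrix.map_one _ (map_zero _) (map_one _), frameJet,
    changeFrame_one, jetFunctional_X_pow]

theorem eval_scale (c : Kˣ) (P : JetRing K) :
    (scale P).eval (C (c : K)) = prolongRing (AffineEquiv.refl K (Fin 2 → K)) c P := by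
  suffices h : ((Polynomial.aeval (C (c : K) : JetRing K)).restrictScalars K).comp scale =
      prolongRing (AffineEquiv.refl K (Fin 2 → K)) c by
    rw [← h, AlgHom.comp_apply, AlgHom.restrictScalars_apply, Polynomial.coe_aeval_eq_eval]
  refine algHom_ext ?_
  rintro (i | ⟨i, j⟩)
  · rw [prolongRing_refl_X_inl]
    simp [scale]
  · change _ = prolongRing _ c (u i j)
    rw [prolongRing_refl_u]
    simp [scale]
    exact mul_comm _ _

theorem eval_one_scale (P : JetRing K) : (scale P).eval 1 = P := by
  have h := eval_scale (1 : Kˣ) P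
  rw [Units.val_one, map_one] at h
  rw [h]
  suffices h : prolongRing (AffineEquiv.refl K (Fin 2 → K)) 1 = AlgHom.id K _ by
    rw [h, AlgHom.id_apply]
  refine algHom_ext ?_
  rintro (i | ⟨i, j⟩)
  · exact prolongRing_refl_X_inl 1 i
  · change prolongRing _ 1 (u i j) = u i j
    rw [prolongRing_refl_u, Units.val_one, map_one, one_mul]

theorem prolong_refl_prolong (A : (Fin 2 → K) ≃ᵃ[K] (Fin 2 → K)) (c : Kˣ) (I : JetField K) :
    prolong (AffineEquiv.refl K (Fin 2 → K)) c (prolong A 1 I) = prolong A c I := by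
  have key : ∀ P : JetRing K, prolongRing (AffineEquiv.refl K (Fin 2 → K)) c
      (prolongRing A 1 P) = prolongRing A c P := by
    intro P
    have hX := prolongRing_refl_X_inl (K := K) c
    have hu := prolongRing_refl_u (K := K) c
    generalize prolongRing (AffineEquiv.refl K (Fin 2 → K)) c = φ at hX hu ⊢
    suffices h : φ.comp (prolongRing A 1) = prolongRing A c from DFunLike.congr_fun h P
    refine algHom_ext ?_
    rintro (i | ⟨i, j⟩)
    · have h : ∀ d : Kˣ, prolongRing A d (X (Sum.inl i)) = C (A 0 i) +
          ∑ l : Fin 2, C (A.linear (Pi.single l 1) i) * X (Sum.inl l) := fun d => by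
        rw [prolongRing, aeval_X, Sum.elim_inl]
      rw [AlgHom.comp_apply, h, h]
      simp only [map_add, map_sum, map_mul, algHom_C, algebraMap_eq, hX]
    · change φ (prolongRing A 1 (u i j)) = prolongRing A c (u i j)
      have h := map_frameJet (φ : JetRing K →+* JetRing K) (C ((1 : Kˣ) : K))
        ((invLinear A).map C) u i j
      have hM : ((invLinear A).map C).map (φ : JetRing K →+* JetRing K) =
          (invLinear A).map C := by
        ext1 l k
        simp [algHom_C]
      have hu' : (fun a b => φ (u a b)) = frameJet (C (c : K)) 1 u := by
        funext a b
        rw [hu, frameJet, changeFrame_one, jetFunctional_X_pow]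
      rw [hM] at h
      simp only [RingHom.coe_coe, algHom_C, algebraMap_eq] at h
      rw [prolongRing_u, h, hu', frameJet_frameJet, Matrix.one_mul, Units.val_one, map_one, one_mul,
        prolongRing_u]
  obtain ⟨a, b, hb, rfl⟩ := exists_toField_div I
  simp only [map_div₀, prolong_toField, key]

theorem C_units_infinite [CharZero K] :
    {x : JetRing K | ∃ c : Kˣ, x = C (c : K)}.Infinite := by
  have h : Set.Infinite {a : K | a ≠ 0} := (Set.finite_singleton (0 : K)).infinite_compl
  refine (h.image (C_injective JetVar K).injOn).mono ?_
  rintro _ ⟨a, ha, rfl⟩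
  exact ⟨Units.mk0 a ha, rfl⟩

/-- Two polynomials with equal logarithmic derivatives, in characteristic zero, are
proportional. -/
theorem mul_C_eval_eq_of_derivative_mul_eq {R : Type*} [CommRing R] [IsDomain R] [CharZero R]
    {a b : Polynomial R} {t : R} (hb : b.eval t ≠ 0)
    (h : Polynomial.derivative a * b = a * Polynomial.derivative b) :
    a * Polynomial.C (b.eval t) = Polynomial.C (a.eval t) * b := by
  set g := a * Polynomial.C (b.eval t) - Polynomial.C (a.eval t) * b with hg
  have hb0 : b ≠ 0 := by
    rintro rfl
    simp at hb
  have hgt : g.IsRoot t := by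
    simp [hg, Polynomial.IsRoot, mul_comm]
  have hgd : Polynomial.derivative g * b = g * Polynomial.derivative b := by
    simp only [hg, Polynomial.derivative_sub, Polynomial.derivative_mul, Polynomial.derivative_C]
    linear_combination Polynomial.C (b.eval t) * h
  -- Otherwise the orders of vanishing at `t` of the two sides of `hgd` would differ.
  by_contra hne
  have hg0 : g ≠ 0 := fun h0 => hne (sub_eq_zero.mp h0)
  have hpos : 0 < g.rootMultiplicity t := (Polynomial.rootMultiplicity_pos hg0).mpr hgt
  have hdg0 : Polynomial.derivative g ≠ 0 := by
    intro h0
    have := Polynomial.derivative_eq_zero.mp h0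
    rw [Polynomial.natDegree_eq_zero] at this
    obtain ⟨r, hr⟩ := this
    rw [← hr, Polynomial.IsRoot, Polynomial.eval_C] at hgt
    exact hg0 (by rw [← hr, hgt, map_zero])
  have hleft : Polynomial.derivative g * b ≠ 0 := mul_ne_zero hdg0 hb0
  have hm := congrArg (Polynomial.rootMultiplicity t) hgd
  rw [Polynomial.rootMultiplicity_mul hleft, Polynomial.rootMultiplicity_mul (hgd ▸ hleft),
    Polynomial.derivative_rootMultiplicity_of_root hgt,
    Polynomial.rootMultiplicity_eq_zero (p := b) hb] at hm
  omega

theorem isCurveInvariant_iff [CharZero K] (I : JetField K) :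
    IsCurveInvariant I ↔ IsAffineInvariant I ∧ HasWeight I 0 := by
  obtain ⟨a, b, hb, rfl⟩ := exists_toField_div I
  have hgamma : ∀ P : JetRing K, (Polynomial.derivative (scale P)).eval 1 = gamma P := fun P => by
    have h := congrArg (Polynomial.eval 1) (X_mul_derivative_scale P)
    rwa [Polynomial.eval_mul, Polynomial.eval_X, one_mul, eval_one_scale] at h
  rw [hasWeight_zero_div_iff hb]
  constructor
  · intro h
    refine ⟨fun A => h A 1, ?_⟩
    have hpoly : scale a * Polynomial.C b = Polynomial.C a * scale b := by
      refine Polynomial.eq_of_infinite_eval_eq _ _ (C_units_infinite.mono ?_)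
      rintro _ ⟨c, rfl⟩
      have := (prolong_div_eq_iff _ c hb).mp (h (AffineEquiv.refl K _) c)
      simpa [eval_scale] using this
    have hd := congrArg (fun p => (Polynomial.derivative p).eval 1) hpoly
    simpa [hgamma, Polynomial.derivative_mul] using hd
  · rintro ⟨hA, hw⟩ A c
    have hlog : Polynomial.derivative (scale a) * scale b =
        scale a * Polynomial.derivative (scale b) := by
      refine mul_left_cancel₀ (Polynomial.X_ne_zero (R := JetRing K)) ?_
      rw [← mul_assoc, X_mul_derivative_scale, mul_left_comm, X_mul_derivative_scale, ← map_mul,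
        ← map_mul, hw]
    have hprop := mul_C_eval_eq_of_derivative_mul_eq (t := 1)
      (by rwa [eval_one_scale]) hlog
    rw [eval_one_scale, eval_one_scale] at hprop
    have hc := congrArg (Polynomial.eval (C (c : K))) hprop
    rw [Polynomial.eval_mul, Polynomial.eval_mul, Polynomial.eval_C, Polynomial.eval_C, eval_scale,
      eval_scale] at hc
    rw [← prolong_refl_prolong, hA A]
    exact (prolong_div_eq_iff _ c hb).mpr hc

end Weight

/-! ### Normalization by the invariant frame -/

section Normalization

variable {K : Type*} [Field K]

/-- A nonzero polynomial over a domain containing an infinite field `K` has a non-root with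
coordinates in `K`. -/
theorem exists_eval_algebraMap_ne_zero [Infinite K] {S σ : Type*} [CommRing S] [IsDomain S]
    [Algebra K S] {p : MvPolynomial σ S} (hp : p ≠ 0) :
    ∃ s : σ → K, eval (fun i => algebraMap K S (s i)) p ≠ 0 := by
  by_contra! h
  refine hp (funext_set (fun _ => Set.range (algebraMap K S))
    (fun _ => Set.infinite_range_of_injective (algebraMap K S).injective) fun x hx => ?_)
  choose s hs using fun i => hx i (Set.mem_univ i)
  rw [map_zero, ← h s]
  congr 1
  congr 1
  exact funext fun i => (hs i).symm

/-- The value at the jet `z` of a polynomial in the jet coordinates alone. -/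
def jetEval {S : Type*} [CommRing S] [Algebra K S] (z : ℕ → ℕ → S) :
    MvPolynomial (ℕ × ℕ) K →ₐ[K] S :=
  aeval fun ij => z ij.1 ij.2

theorem map_jetEval {S S' : Type*} [CommRing S] [Algebra K S] [CommRing S'] [Algebra K S']
    (f : S →ₐ[K] S') (z : ℕ → ℕ → S) (p : MvPolynomial (ℕ × ℕ) K) :
    f (jetEval z p) = jetEval (fun i j => f (z i j)) p := by
  suffices h : f.comp (jetEval z) = jetEval (fun i j => f (z i j)) from DFunLike.congr_fun h p
  refine algHom_ext fun ij => ?_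
  simp [jetEval]

theorem jetEval_uf (p : MvPolynomial (ℕ × ℕ) K) :
    jetEval uf p = toField (rename Sum.inr p) := by
  have h := map_jetEval (IsScalarTower.toAlgHom K (JetRing K) (JetField K)) u p
  have h2 : jetEval u p = (rename Sum.inr p : JetRing K) := by
    rw [rename_eq_aeval]
    rfl
  rw [← h2]
  exact h.symm

theorem jetEval_uf_ne_zero {p : MvPolynomial (ℕ × ℕ) K} (hp : p ≠ 0) :
    (jetEval uf p : JetField K) ≠ 0 := by
  rw [jetEval_uf]
  refine toField_ne_zero fun h => hp ?_
  exact rename_injective Sum.inr Sum.inr_injective (by rw [h, map_zero])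

theorem invLinear_constVAdd (t : Fin 2 → K) :
    invLinear (AffineEquiv.constVAdd K (Fin 2 → K) t) = 1 := by
  ext l k
  simp [invLinear, Matrix.one_apply, Pi.single_apply]

/-- A translation-invariant rational function does not involve the base coordinates: translating
the base point to a suitable `K`-point `t` removes them. -/
theorem exists_jetEval_div_of_isAffineInvariant [CharZero K] {I : JetField K}
    (hI : IsAffineInvariant I) :
    ∃ p q : MvPolynomial (ℕ × ℕ) K, q ≠ 0 ∧ I = jetEval uf p / jetEval uf q := by
  obtain ⟨a, b, hb, rfl⟩ := exists_toField_div I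
  let G : JetRing K →ₐ[K] MvPolynomial (Fin 2) (JetRing K) :=
    aeval (Sum.elim (fun i => X i + C (X (Sum.inl i))) fun ij => C (X (Sum.inr ij)))
  let sp (t : Fin 2 → K) : JetRing K →ₐ[K] MvPolynomial (ℕ × ℕ) K :=
    aeval (Sum.elim (fun i => C (t i)) X)
  have hG : ∀ (t : Fin 2 → K) (P : JetRing K),
      eval (fun i => algebraMap K (JetRing K) (t i)) (G P) =
        prolongRing (AffineEquiv.constVAdd K (Fin 2 → K) t) 1 P := by
    intro t P
    suffices h : ((aeval fun i => algebraMap K (JetRing K) (t i)).restrictScalars K).comp G =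
        prolongRing (AffineEquiv.constVAdd K (Fin 2 → K) t) 1 by
      rw [← h, AlgHom.comp_apply, AlgHom.restrictScalars_apply, aeval_eq_eval]
    refine algHom_ext ?_
    rintro (i | ⟨i, j⟩)
    · simp only [G, AlgHom.comp_apply, aeval_X, Sum.elim_inl, AlgHom.restrictScalars_apply, map_add,
        algHom_C, prolongRing, Fin.sum_univ_two]
      rcases (by omega : i = 0 ∨ i = 1) with rfl | rfl <;> simp
    · change _ = prolongRing _ 1 (u i j)
      rw [prolongRing_u, invLinear_constVAdd, Matrix.map_one _ (map_zero _) (map_one _),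
        Units.val_one, map_one, frameJet_one]
      simp [G, u]
  have hident : G a * C b = C a * G b := by
    have : Infinite K := CharZero.infinite K
    by_contra hne
    obtain ⟨t, ht⟩ := exists_eval_algebraMap_ne_zero (K := K) (sub_ne_zero.mpr hne)
    apply ht
    have := (prolong_div_eq_iff _ 1 hb).mp (hI (AffineEquiv.constVAdd K (Fin 2 → K) t))
    rw [map_sub, map_mul, map_mul, hG, hG, eval_C, eval_C, this, sub_self]
  -- The parameter `t - x` moves the generic base point `x` to the constant point `t`.
  have hsp : ∀ (t : Fin 2 → K) (P : JetRing K),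
      eval (fun i => C (t i) - X (Sum.inl i)) (G P) = rename Sum.inr (sp t P) := by
    intro t P
    suffices h : ((aeval fun i => (C (t i) - X (Sum.inl i) : JetRing K)).restrictScalars K).comp G =
        (rename Sum.inr).comp (sp t) by
      rw [← AlgHom.comp_apply (rename Sum.inr), ← h, AlgHom.comp_apply,
        AlgHom.restrictScalars_apply, aeval_eq_eval]
    refine algHom_ext ?_
    rintro (i | ij)
    · simp [G, sp]
    · simp [G, sp]
  obtain ⟨t, ht⟩ : ∃ t : Fin 2 → K, sp t b ≠ 0 := by
    have : Infinite K := CharZero.infinite K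
    have hb' : sumAlgEquiv K (Fin 2) (ℕ × ℕ) b ≠ 0 := by simpa using hb
    obtain ⟨t, ht⟩ := exists_eval_algebraMap_ne_zero (K := K) hb'
    refine ⟨t, ?_⟩
    have h : ((aeval fun i => algebraMap K (MvPolynomial (ℕ × ℕ) K) (t i)).restrictScalars K).comp
        (sumAlgEquiv K (Fin 2) (ℕ × ℕ)).toAlgHom = sp t := by
      refine algHom_ext ?_
      rintro (i | ij)
      · simp [sp, algebraMap_eq]
      · simp [sp]
    rw [← h, AlgHom.comp_apply, AlgHom.restrictScalars_apply, aeval_eq_eval]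
    exact ht
  refine ⟨sp t a, sp t b, ht, ?_⟩
  have h := congrArg (eval fun i => (C (t i) - X (Sum.inl i) : JetRing K)) hident
  rw [map_mul, map_mul, eval_C, eval_C, hsp, hsp] at h
  rw [div_eq_div_iff (toField_ne_zero hb) (jetEval_uf_ne_zero ht), jetEval_uf, jetEval_uf,
    ← map_mul, ← map_mul, ← h, mul_comm]

/-- Every nondegenerate matrix comes from an affine transformation. -/
theorem exists_invLinear_eq {M : Matrix (Fin 2) (Fin 2) K} (hM : M.det ≠ 0) :
    ∃ A : (Fin 2 → K) ≃ᵃ[K] (Fin 2 → K), invLinear A = M := by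
  have hM' : Invertible M := M.invertibleOfIsUnitDet hM.isUnit
  refine ⟨(Matrix.toLinearEquiv' M hM').symm.toAffineEquiv, ?_⟩
  ext l k
  change Matrix.toLin' M (Pi.single k 1) l = M l k
  simp

theorem prolong_jetEval_uf (A : (Fin 2 → K) ≃ᵃ[K] (Fin 2 → K)) (c : Kˣ)
    (p : MvPolynomial (ℕ × ℕ) K) :
    prolong A c (jetEval uf p) =
      jetEval (frameJet (algebraMap K (JetField K) c) (invLinearField A) uf) p := by
  rw [map_jetEval]
  congr 2
  funext i j
  exact prolong_uf A c i j

/-- The parameters `(c, M)` of a change of frame: a factor and the entries of a matrix. -/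
abbrev FrameParam : Type := Option (Fin 2 × Fin 2)

/-- The matrix formed by a family of frame parameters. -/
def paramMatrix {S : Type*} (s : FrameParam → S) : Matrix (Fin 2) (Fin 2) S :=
  Matrix.of fun l k => s (some (l, k))

/-- The change of frame of the jet `z` with indeterminate parameters. -/
def genericJet {S : Type*} [CommRing S] (z : ℕ → ℕ → S) : ℕ → ℕ → MvPolynomial FrameParam S :=
  frameJet (X none) (paramMatrix X) fun i j => C (z i j)

theorem eval_jetEval_genericJet {S : Type*} [CommRing S] [Algebra K S] (z : ℕ → ℕ → S)
    (s : FrameParam → S) (p : MvPolynomial (ℕ × ℕ) K) :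
    eval s (jetEval (genericJet z) p) = jetEval (frameJet (s none) (paramMatrix s) z) p := by
  have h := map_jetEval ((aeval s : MvPolynomial FrameParam S →ₐ[S] S).restrictScalars K)
    (genericJet z) p
  rw [AlgHom.restrictScalars_apply, aeval_eq_eval] at h
  refine Eq.trans h ?_
  congr 2
  funext i j
  rw [AlgHom.restrictScalars_apply, aeval_eq_eval]
  refine Eq.trans (map_frameJet (eval s) _ _ _ i j) ?_
  have hM : (paramMatrix (X : FrameParam → MvPolynomial FrameParam S)).map (eval s) =
      paramMatrix s := by
    ext l k
    simp [paramMatrix]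
  rw [hM, eval_X]
  simp only [eval_C]

theorem eval_det_paramMatrix {S : Type*} [CommRing S] (s : FrameParam → S) :
    eval s (paramMatrix X).det = (paramMatrix s).det := by
  simp [Matrix.det_fin_two, paramMatrix]

/-- The family of parameters that consists of `c` and the entries of `M`. -/
def param {S : Type*} (c : S) (M : Matrix (Fin 2) (Fin 2) S) : FrameParam → S :=
  fun o => o.elim c fun lk => M lk.1 lk.2

theorem paramMatrix_param {S : Type*} (c : S) (M : Matrix (Fin 2) (Fin 2) S) :
    paramMatrix (param c M) = M := rfl

theorem param_none {S : Type*} (c : S) (M : Matrix (Fin 2) (Fin 2) S) :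
    param c M none = c := rfl

/-- If a polynomial in the frame parameters does not vanish at some nondegenerate point over the
field of rational functions, it does not vanish at some nondegenerate `K`-point. -/
theorem exists_prolong_param [CharZero K] {g : MvPolynomial FrameParam (JetField K)}
    {c : JetField K} {M : Matrix (Fin 2) (Fin 2) (JetField K)} (hc : c ≠ 0) (hM : M.det ≠ 0)
    (hg : eval (param c M) g ≠ 0) :
    ∃ (A : (Fin 2 → K) ≃ᵃ[K] (Fin 2 → K)) (e : Kˣ),
      eval (param (algebraMap K (JetField K) e) (invLinearField A)) g ≠ 0 := by
  have : Infinite K := CharZero.infinite K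
  have h : g * (X none * (paramMatrix X).det) ≠ 0 := by
    intro h
    have h2 := congrArg (eval (param c M)) h
    rw [map_mul, map_mul, eval_X, eval_det_paramMatrix, map_zero] at h2
    exact mul_ne_zero hg (mul_ne_zero hc hM) h2
  obtain ⟨s, hs⟩ := exists_eval_algebraMap_ne_zero (K := K) h
  rw [map_mul, map_mul, eval_X, eval_det_paramMatrix] at hs
  have hs1 := left_ne_zero_of_mul hs
  have hs2 : s none ≠ 0 := fun h0 => by simp [h0] at hs
  have hs3 : (paramMatrix s).det ≠ 0 := by
    intro h0
    apply right_ne_zero_of_mul (right_ne_zero_of_mul hs)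
    have h1 := RingHom.map_det (algebraMap K (JetField K)) (paramMatrix s)
    rw [h0, map_zero] at h1
    exact h1.symm
  obtain ⟨A, hA⟩ := exists_invLinear_eq hs3
  refine ⟨A, Units.mk0 _ hs2, ?_⟩
  have hparam : param (algebraMap K (JetField K) (s none)) (invLinearField A) =
      fun i => algebraMap K (JetField K) (s i) := by
    funext o
    rcases o with _ | ⟨l, k⟩
    · rfl
    · simp [param, invLinearField, hA, paramMatrix]
  rw [Units.val_mk0, hparam]
  exact hs1

/-- Invariance under the transformations over the infinite field `K` is a polynomial identity in
the parameters, hence it holds for parameters that are themselves rational functions on the jets. -/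
theorem jetEval_frameJet_mul [CharZero K] {p q : MvPolynomial (ℕ × ℕ) K} (hq : q ≠ 0)
    (hI : IsCurveInvariant (jetEval uf p / jetEval uf q : JetField K)) {c : JetField K}
    {M : Matrix (Fin 2) (Fin 2) (JetField K)} (hc : c ≠ 0) (hM : M.det ≠ 0) :
    jetEval (frameJet c M uf) p * jetEval uf q = jetEval uf p * jetEval (frameJet c M uf) q := by
  set g : MvPolynomial FrameParam (JetField K) :=
    jetEval (genericJet uf) p * C (jetEval uf q) - C (jetEval uf p) * jetEval (genericJet uf) q
    with hgdef
  have hg : ∀ (d : JetField K) (N : Matrix (Fin 2) (Fin 2) (JetField K)), eval (param d N) g =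
      jetEval (frameJet d N uf) p * jetEval uf q - jetEval uf p * jetEval (frameJet d N uf) q := by
    intro d N
    rw [hgdef, map_sub, map_mul, map_mul, eval_C, eval_C, eval_jetEval_genericJet,
      eval_jetEval_genericJet, paramMatrix_param, param_none]
  by_contra hne
  obtain ⟨A, e, h⟩ := exists_prolong_param hc hM (g := g) (by rwa [hg, sub_ne_zero])
  rw [hg, ← prolong_jetEval_uf, ← prolong_jetEval_uf, sub_ne_zero] at h
  have hq' := jetEval_uf_ne_zero hq
  have hinv := hI A e
  rw [map_div₀, div_eq_div_iff ((map_ne_zero _).mpr hq') hq'] at hinv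
  exact h hinv

/-- Any jet obtained from the given one by a transformation over the field of rational functions
can be substituted into a suitable representation of an invariant as a fraction. -/
theorem exists_eq_jetEval_div [CharZero K] {I : JetField K} (hI : IsCurveInvariant I)
    {c : JetField K} {M : Matrix (Fin 2) (Fin 2) (JetField K)} (hc : c ≠ 0) (hM : M.det ≠ 0) :
    ∃ p q : MvPolynomial (ℕ × ℕ) K,
      I = jetEval (frameJet c M uf) p / jetEval (frameJet c M uf) q := by
  obtain ⟨p, q, hq, hpq⟩ := exists_jetEval_div_of_isAffineInvariant fun A => hI A 1
  -- The denominator may vanish at the substituted jet; a generic transformation over `K` moves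
  -- the jet off its zero set, because the inverse of `(c, M)` does.
  obtain ⟨A, e, hAe⟩ := exists_prolong_param (K := K)
    (g := jetEval (genericJet (frameJet c M uf)) q) (inv_ne_zero hc)
    (M := M⁻¹) (Matrix.isUnit_nonsing_inv_det M hM.isUnit).ne_zero (by
      rw [eval_jetEval_genericJet, paramMatrix_param, param_none, frameJet_frameJet,
        Matrix.mul_nonsing_inv _ hM.isUnit, inv_mul_cancel₀ hc, frameJet_one]
      exact jetEval_uf_ne_zero hq)
  rw [eval_jetEval_genericJet, paramMatrix_param, param_none] at hAe
  let w : ℕ → ℕ → MvPolynomial (ℕ × ℕ) K :=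
    frameJet (C (e : K)) ((invLinear A).map C) fun i j => X (i, j)
  have hw : ∀ (z : ℕ → ℕ → JetField K) (r : MvPolynomial (ℕ × ℕ) K),
      jetEval z (jetEval w r) =
        jetEval (frameJet (algebraMap K (JetField K) e) (invLinearField A) z) r := by
    intro z r
    rw [map_jetEval]
    congr 2
    funext i j
    have h := map_frameJet ((jetEval z : MvPolynomial (ℕ × ℕ) K →ₐ[K] JetField K) :
      MvPolynomial (ℕ × ℕ) K →+* JetField K) (C (e : K))
      ((invLinear A).map C) (fun i j => X (i, j)) i j
    have hM : ((invLinear A).map C).map ((jetEval z : MvPolynomial (ℕ × ℕ) K →ₐ[K] JetField K) :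
      MvPolynomial (ℕ × ℕ) K →+* JetField K) =
        invLinearField A := by
      ext l k
      simp [invLinearField, algHom_C]
    rw [hM] at h
    refine Eq.trans h ?_
    simp [algHom_C, jetEval]
  have hI' : I = jetEval uf (jetEval w p) / jetEval uf (jetEval w q) := by
    rw [hw, hw, ← prolong_jetEval_uf, ← prolong_jetEval_uf, ← map_div₀, ← hpq, hI A e]
  refine ⟨jetEval w p, jetEval w q, ?_⟩
  rw [← hw] at hAe
  have hq' : jetEval w q ≠ 0 := fun h => hAe (by rw [h, map_zero])
  have h := jetEval_frameJet_mul hq' (hI' ▸ hI) hc hM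
  rw [hI', div_eq_div_iff (jetEval_uf_ne_zero hq') hAe]
  exact h.symm

theorem jetEval_mem_adjoin (z : ℕ → ℕ → JetField K) (p : MvPolynomial (ℕ × ℕ) K) :
    jetEval z p ∈ IntermediateField.adjoin K (Set.range fun ij : ℕ × ℕ => z ij.1 ij.2) := by
  induction p using MvPolynomial.induction_on with
  | C a => rw [algHom_C]; exact IntermediateField.algebraMap_mem _ a
  | add p q hp hq => rw [map_add]; exact add_mem hp hq
  | mul_X p ij hp =>
    rw [map_mul]
    refine mul_mem hp (IntermediateField.subset_adjoin K _ ⟨ij, ?_⟩)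
    simp [jetEval]

theorem isCurveInvariant_iff_mem_adjoin [CharZero K] (I : JetField K) :
    IsCurveInvariant I ↔ I ∈ IntermediateField.adjoin K (Set.range fun ij : ℕ × ℕ =>
      (tensorInvariant ij.1 ij.2 * I₀ ^ ((ij.1 : ℤ) + (ij.2 : ℤ) - 1) : JetField K)) := by
  refine ⟨fun hI => ?_, isCurveInvariant_of_mem_adjoin⟩
  have hdet : (normalFrame (K := K)).det ≠ 0 := by
    rw [normalFrame, Matrix.det_smul]
    exact mul_ne_zero (pow_ne_zero _ I₀_ne_zero)
      (Matrix.isUnit_nonsing_inv_det _ isUnit_det_coframe).ne_zero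
  obtain ⟨p, q, h⟩ := exists_eq_jetEval_div hI (inv_ne_zero I₀_ne_zero) hdet
  simp only [normalInvariant_eq_frameJet]
  rw [h]
  exact div_mem (jetEval_mem_adjoin _ p) (jetEval_mem_adjoin _ q)

end Normalization

end

end AffineJets

theorem mainTheorem8 (K : Type*) [Field K] [CharZero K] :
    (∀ I : AffineJets.JetField K, AffineJets.IsCurveInvariant I ↔
      AffineJets.IsAffineInvariant I ∧ AffineJets.HasWeight I 0) ∧
    (∀ I : AffineJets.JetField K, AffineJets.IsCurveInvariant I ↔
      I ∈ IntermediateField.adjoin K (Set.range fun ij : ℕ × ℕ =>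
        (AffineJets.tensorInvariant ij.1 ij.2 *
          AffineJets.I₀ ^ ((ij.1 : ℤ) + (ij.2 : ℤ) - 1) : AffineJets.JetField K))) :=
  ⟨AffineJets.isCurveInvariant_iff, AffineJets.isCurveInvariant_iff_mem_adjoin⟩
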